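/- All graphs and digraphs are finite; graphs are simple, and digraphs have no loops and no parallel arcs (two opposite arcs between the same vertices are allowed). For vertices $u,v$ of a digraph $D$ let $d_D(u,v)$ be the length of a shortest directed $(u,v)$-path if $D$ contains such a path, and $d_D(u,v)=0$ otherwise. The Wiener index of $D$ is $W(D)=\sum_{(u,v)\in V\times V} d_D(u,v)$. The digraph $D$ is transitive if, for all distinct vertices $u,v$, whenever there is a directed path from $u$ to $v$ in $D$, then $\overrightarrow{uv}$ is an arc of $D$. An orientation of a graph $G$ is a digraph obtained by giving each edge of $G$ exactly one of its two directions. (1) If $D$ is a digraph with $m$ arcs, then $W(D)\ge m$, with equality if and only if $D$ is transitive. (2) If $G$ is a graph with $m$ edges, then every orientation of $G$ has Wiener index at least $m$, and $G$ has an orientation of Wiener index $m$ if and only if $G$ has a transitive orientation. (3) It can be decided in time $O(n^2)$ whether a given graph of order $n$ has a transitive orientation. Likewise, it can be decided in time $O(n^2)$ whether a given graph of order $n$ with $m$ edges has an orientation of Wiener index $m$. Here the graph is given by its adjacency matrix, and time is the number of instructions executed by a random access machine under the uniform cost criterion; its registers and memory cells hold natural numbers of arbitrary size, and its instructions are: loading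 a constant, addition, truncated subtraction, bitwise conjunction, indirect reading and writing of memory, and jumps (unconditional, or if a register is zero). -/

import Mathlib

open Asymptotics Filter

namespace Digraph

variable {V : Type*}

/-- `D` contains a directed path of length `k` from `u` to `v`: a sequence of `k + 1` distinct
vertices, the first `u` and the last `v`, with an arc from each vertex to the next one. -/
def HasPath (D : Digraph V) (u v : V) (k : ℕ) : Prop :=
  ∃ p : Fin (k + 1) → V, Function.Injective p ∧ p 0 = u ∧ p (Fin.last k) = v ∧
    ∀ i : Fin k, D.Adj (p i.castSucc) (p i.succ)

open Classical in
/-- The distance from `u` to `v`: the length of a shortest `(u,v)`-path if there is one, and `0`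
if there is none. -/
noncomputable def distance (D : Digraph V) (u v : V) : ℕ :=
  if h : ∃ k, D.HasPath u v k then Nat.find h else 0

/-- The Wiener index: the sum of the distances over all ordered pairs of vertices. -/
noncomputable def wienerIndex [Fintype V] (D : Digraph V) : ℕ :=
  ∑ u : V, ∑ v : V, D.distance u v

/-- The number of arcs. -/
noncomputable def numArcs (D : Digraph V) : ℕ :=
  {a : V × V | D.Adj a.1 a.2}.ncard

/-- No arc joins a vertex to itself. -/
def Loopless (D : Digraph V) : Prop :=
  ∀ v : V, ¬ D.Adj v v

/-- Whenever there is a path from a vertex `u` to another vertex `v`, there is an arc from `u`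
to `v`. -/
def IsTransitive (D : Digraph V) : Prop :=
  ∀ u v : V, u ≠ v → (∃ k, D.HasPath u v k) → D.Adj u v

/-- `D` is an orientation of `G`: it arises by giving each edge of `G` exactly one of its two
directions. -/
def IsOrientationOf (D : Digraph V) (G : SimpleGraph V) : Prop :=
  (∀ u v : V, G.Adj u v ↔ D.Adj u v ∨ D.Adj v u) ∧ ∀ u v : V, ¬ (D.Adj u v ∧ D.Adj v u)

end Digraph

namespace SimpleGraph

/-- The number of edges. -/
noncomputable def numEdges {V : Type*} (G : SimpleGraph V) : ℕ :=
  G.edgeSet.ncard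

/-- `G` has an orientation that is a transitive digraph. -/
def HasTransitiveOrientation {V : Type*} (G : SimpleGraph V) : Prop :=
  ∃ D : Digraph V, D.IsOrientationOf G ∧ D.IsTransitive

/-- `G` has an orientation whose Wiener index is the number of edges of `G`. -/
def HasOrientationOfWienerIndexNumEdges {V : Type*} [Fintype V] (G : SimpleGraph V) : Prop :=
  ∃ D : Digraph V, D.IsOrientationOf G ∧ D.wienerIndex = G.numEdges

end SimpleGraph

/-! Random access machines under the uniform cost criterion. -/

namespace RAM

/-- The instructions. A machine has registers (named directly by the program) and memory cells
(reached by indirect addressing), all holding natural numbers. The numbers `d`, `a`, `b` are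
names of registers and `l` is a position in the program. -/
inductive Instr where
  /-- put the constant `c` into register `d` -/
  | const (d c : ℕ)
  /-- put the sum of registers `a` and `b` into register `d` -/
  | add (d a b : ℕ)
  /-- put the truncated difference of registers `a` and `b` into register `d` -/
  | sub (d a b : ℕ)
  /-- put the bitwise conjunction of registers `a` and `b` into register `d` -/
  | band (d a b : ℕ)
  /-- put into register `d` the memory cell whose address is in register `a` -/
  | load (d a : ℕ)
  /-- put register `b` into the memory cell whose address is in register `a` -/
  | store (a b : ℕ)
  /-- continue at position `l` -/
  | jump (l : ℕ)
  /-- continue at position `l` if register `a` is zero, with the next instruction otherwise -/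
  | jumpZero (a l : ℕ)

/-- A configuration: the program counter, the registers and the memory. -/
structure State where
  pc : ℕ
  reg : ℕ → ℕ
  mem : ℕ → ℕ

/-- The effect of one instruction. -/
def Instr.exec : Instr → State → State
  | .const d c, s => ⟨s.pc + 1, Function.update s.reg d c, s.mem⟩
  | .add d a b, s => ⟨s.pc + 1, Function.update s.reg d (s.reg a + s.reg b), s.mem⟩
  | .sub d a b, s => ⟨s.pc + 1, Function.update s.reg d (s.reg a - s.reg b), s.mem⟩
  | .band d a b, s => ⟨s.pc + 1, Function.update s.reg d (s.reg a &&& s.reg b), s.mem⟩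
  | .load d a, s => ⟨s.pc + 1, Function.update s.reg d (s.mem (s.reg a)), s.mem⟩
  | .store a b, s => ⟨s.pc + 1, s.reg, Function.update s.mem (s.reg a) (s.reg b)⟩
  | .jump l, s => ⟨l, s.reg, s.mem⟩
  | .jumpZero a l, s => ⟨if s.reg a = 0 then l else s.pc + 1, s.reg, s.mem⟩

/-- A program is a finite list of instructions. -/
abbrev Program := List Instr

/-- The machine has halted when the program counter has left the program. -/
def Halted (P : Program) (s : State) : Prop :=
  P.length ≤ s.pc

/-- One step of the machine, executing the current instruction; a halted machine stays as it
is. -/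
def step (P : Program) (s : State) : State :=
  match P[s.pc]? with
  | some i => i.exec s
  | none => s

open Classical in
/-- The initial configuration for a graph `G` on the vertices `0, …, n - 1`: register `0` holds
`n`, the first `n ^ 2` memory cells hold the adjacency matrix of `G` row by row, and everything
else is zero. -/
noncomputable def input {n : ℕ} (G : SimpleGraph (Fin n)) : State where
  pc := 0
  reg := fun r => if r = 0 then n else 0
  mem := fun x => if ∃ i j : Fin n, x = (i : ℕ) * n + (j : ℕ) ∧ G.Adj i j then 1 else 0

open Classical in
/-- On every graph `G` with `n` vertices the program `P` halts after at most `T n` steps, and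
register `0` then holds `1` if `G` has the property `Q` and `0` if it has not. -/
def DecidesWithin (P : Program) (Q : ∀ n : ℕ, SimpleGraph (Fin n) → Prop) (T : ℕ → ℕ) : Prop :=
  ∀ (n : ℕ) (G : SimpleGraph (Fin n)),
    Halted P ((step P)^[T n] (input G)) ∧
      ((step P)^[T n] (input G)).reg 0 = if Q n G then 1 else 0

/-- A single program decides the graph property `Q` in time `O(f(n))` on graphs of order `n`. -/
def DecidableInTimeO (Q : ∀ n : ℕ, SimpleGraph (Fin n) → Prop) (f : ℕ → ℝ) : Prop :=
  ∃ (P : Program) (T : ℕ → ℕ),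
    (fun n => (T n : ℝ)) =O[atTop] f ∧ DecidesWithin P Q T

end RAM

/-!
The first two parts compare distances with arcs one pair of vertices at a time. In a digraph without
loops, an arc from `u` to `v` gives distance `1`, and a pair without an arc contributes `0` exactly
if there is no path (`Digraph.wienerIndex_eq_numArcs_iff`). An orientation of a graph has one arc
for each edge, so the orientations with the least possible Wiener index are the transitive ones.

For the third part it remains to decide in quadratic time whether there is a transitive
orientation. Two arcs force each other if they share a tail and their heads are not adjacent, or
share a head and their tails are not adjacent; the classes of the generated equivalence are the
implication classes. A transitive orientation contains with an arc its whole class, so no class can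
contain an arc and its reverse. Conversely, if no class does, then orienting every edge such that
the lexicographically smallest arc of its class precedes that of the opposite class gives a transitive
orientation: a failure of transitivity would be a directed triangle, and in a triangle the classes
of two sides determine how the third vertex is joined to all arcs of the class of the third side
(`SimpleGraph.ForcesStar.triangle`), which contradicts the minimal choice
(`SimpleGraph.lexOrientation_no_directed_triangle`).

The implication classes are explored by a search that expands each arc once. As registers hold
numbers of arbitrary size, a set of arcs can be kept in one register, with the arc `(i, j)` as the
binary digit in position `i * n + j`. Intersection is then the bitwise conjunction, disjoint union
is addition, and removal of a subset is subtraction. The arcs forced by `(a, b)` with the same tail are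
those in row `a` whose head is not adjacent to `b`; with tables for the rows, the columns and the
neighbourhoods, they are found in a constant number of instructions, and so are those with the same
head. The lowest arc in a set `w` is the power of two `w - (w &&& (w - 1))`, and since memory
addresses are unbounded as well, it serves directly as an index into tables that give its end
vertices. The tables are computed in two passes over all pairs of vertices, and the search
takes one round for each arc (`RAM.exec_explore`).

The program is written in a small structured language and compiled to machine instructions. A
command without loops runs for at most as many steps as it has instructions
(`RAM.Cmd.LoopFree.exists_runs`), and each loop of the program has at most `n * n` rounds, so the
whole program takes at most `(n * n + 1)` times its length (`RAM.triple_decideOrientation`).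
-/

/-! ### Distances and the Wiener index -/

namespace Digraph

variable {V : Type*}

theorem hasPath_self (D : Digraph V) (u : V) : D.HasPath u u 0 :=
  ⟨fun _ => u, fun i j _ => Subsingleton.elim (α := Fin 1) i j, rfl, rfl, fun i => i.elim0⟩

theorem hasPath_one {D : Digraph V} {u v : V} (huv : u ≠ v) (h : D.Adj u v) :
    D.HasPath u v 1 := by
  refine ⟨![u, v], ?_, rfl, rfl, ?_⟩
  · intro i j hij
    fin_cases i <;> fin_cases j <;> simp_all
  · intro i
    fin_cases i
    simpa using h

theorem HasPath.eq {D : Digraph V} {u v : V} (h : D.HasPath u v 0) : u = v := by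
  obtain ⟨p, -, h0, h1, -⟩ := h
  exact h0.symm.trans h1

theorem HasPath.adj {D : Digraph V} {u v : V} (h : D.HasPath u v 1) : D.Adj u v := by
  obtain ⟨p, -, h0, h1, h⟩ := h
  have := h 0
  rwa [← h0, ← h1]

theorem distance_self (D : Digraph V) (u : V) : D.distance u u = 0 := by
  classical
  have h : ∃ k, D.HasPath u u k := ⟨0, D.hasPath_self u⟩
  rw [distance, dif_pos h, Nat.find_eq_zero]
  exact D.hasPath_self u

theorem distance_eq_one {D : Digraph V} {u v : V} (huv : u ≠ v) (h : D.Adj u v) :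
    D.distance u v = 1 := by
  classical
  have hp : ∃ k, D.HasPath u v k := ⟨1, hasPath_one huv h⟩
  rw [distance, dif_pos hp, Nat.find_eq_iff]
  refine ⟨hasPath_one huv h, fun k hk hk' => huv ?_⟩
  obtain rfl : k = 0 := by omega
  exact hk'.eq

theorem distance_eq_zero_iff {D : Digraph V} {u v : V} (huv : u ≠ v) :
    D.distance u v = 0 ↔ ¬ ∃ k, D.HasPath u v k := by
  classical
  rw [distance]
  split_ifs with h
  · simp only [Nat.find_eq_zero, not_exists]
    exact ⟨fun h0 => absurd h0.eq huv, fun h' => absurd h (by simpa using h')⟩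
  · simpa using h

open Classical in
theorem numArcs_eq_sum [Fintype V] (D : Digraph V) :
    D.numArcs = ∑ u : V, ∑ v : V, if D.Adj u v then 1 else 0 := by
  rw [← Fintype.sum_prod_type' (f := fun u v => if D.Adj u v then 1 else 0),
    Finset.sum_boole, numArcs, Set.ncard_eq_toFinset_card']
  simp

open Classical in
theorem indicator_adj_le_distance {D : Digraph V} (hD : D.Loopless) (u v : V) :
    (if D.Adj u v then 1 else 0) ≤ D.distance u v := by
  split_ifs with h
  · exact (distance_eq_one (by rintro rfl; exact hD _ h) h).ge
  · exact Nat.zero_le _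

theorem numArcs_le_wienerIndex [Fintype V] {D : Digraph V} (hD : D.Loopless) :
    D.numArcs ≤ D.wienerIndex := by
  classical
  rw [numArcs_eq_sum]
  exact Finset.sum_le_sum fun u _ => Finset.sum_le_sum fun v _ => indicator_adj_le_distance hD u v

theorem wienerIndex_eq_numArcs_iff [Fintype V] {D : Digraph V} (hD : D.Loopless) :
    D.wienerIndex = D.numArcs ↔ D.IsTransitive := by
  classical
  have key : D.wienerIndex = D.numArcs ↔
      ∀ u v, (if D.Adj u v then 1 else 0) = D.distance u v := by
    rw [eq_comm, numArcs_eq_sum, wienerIndex, Finset.sum_eq_sum_iff_of_le fun u _ =>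
      Finset.sum_le_sum fun v _ => indicator_adj_le_distance hD u v]
    simp only [Finset.mem_univ, forall_const]
    refine forall_congr' fun u => ?_
    rw [Finset.sum_eq_sum_iff_of_le fun v _ => indicator_adj_le_distance hD u v]
    simp
  rw [key]
  constructor
  · intro h u v huv hp
    by_contra hadj
    have := h u v
    rw [if_neg hadj, eq_comm, distance_eq_zero_iff huv] at this
    exact this hp
  · intro h u v
    rcases eq_or_ne u v with rfl | huv
    · rw [if_neg (hD u), distance_self]
    · split_ifs with hadj
      · exact (distance_eq_one huv hadj).symm
      · exact ((distance_eq_zero_iff huv).2 fun hp => hadj (h u v huv hp)).symm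

theorem IsOrientationOf.loopless {D : Digraph V} {G : SimpleGraph V} (h : D.IsOrientationOf G) :
    D.Loopless :=
  fun v hv => h.2 v v ⟨hv, hv⟩

theorem IsOrientationOf.numArcs_eq {D : Digraph V} {G : SimpleGraph V}
    (h : D.IsOrientationOf G) : D.numArcs = G.numEdges := by
  refine Set.ncard_congr (fun a _ => s(a.1, a.2)) ?_ ?_ ?_
  · rintro ⟨u, v⟩ huv
    exact (h.1 u v).2 (Or.inl huv)
  · rintro ⟨u, v⟩ ⟨u', v'⟩ huv huv' he
    rcases Sym2.eq_iff.1 he with ⟨rfl, rfl⟩ | ⟨rfl, rfl⟩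
    · rfl
    · exact absurd ⟨huv, huv'⟩ (h.2 _ _)
  · intro e he
    induction e with
    | h u v =>
      rcases (h.1 u v).1 he with huv | hvu
      · exact ⟨(u, v), huv, rfl⟩
      · exact ⟨(v, u), hvu, Sym2.eq_swap⟩

/-- For an orientation, transitivity need only be tested on paths with two arcs. -/
theorem IsOrientationOf.isTransitive_iff {D : Digraph V} {G : SimpleGraph V}
    (h : D.IsOrientationOf G) :
    D.IsTransitive ↔ ∀ u v w, D.Adj u v → D.Adj v w → D.Adj u w := by
  constructor
  · intro ht u v w huv hvw
    have huw : u ≠ w := by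
      rintro rfl
      exact h.2 u v ⟨huv, hvw⟩
    refine ht u w huw ⟨2, ![u, v, w], ?_, rfl, rfl, ?_⟩
    · have h1 : u ≠ v := fun e => h.loopless v (e ▸ huv)
      have h2 : v ≠ w := fun e => h.loopless w (e ▸ hvw)
      intro i j hij
      fin_cases i <;> fin_cases j <;> simp_all
    · intro i
      fin_cases i
      · exact huv
      · exact hvw
  · rintro ht u v huv ⟨k, p, -, h0, h1, hp⟩
    have key : ∀ i : ℕ, ∀ hi : i < k + 1, i ≠ 0 → D.Adj u (p ⟨i, hi⟩) := by
      intro i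
      induction i with
      | zero => intro _ h; exact absurd rfl h
      | succ i ih =>
        intro hi _
        have hstep : D.Adj (p ⟨i, by omega⟩) (p ⟨i + 1, hi⟩) := hp ⟨i, by omega⟩
        rcases Nat.eq_zero_or_pos i with rfl | hpos
        · have : p ⟨0, by omega⟩ = u := h0
          rwa [this] at hstep
        · exact ht _ _ _ (ih (by omega) hpos.ne') hstep
    rw [← h1]
    refine key k (by omega) ?_
    rintro rfl
    exact huv (h0.symm.trans h1)

end Digraph

theorem SimpleGraph.hasOrientationOfWienerIndexNumEdges_iff {V : Type*} [Fintype V]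
    (G : SimpleGraph V) :
    G.HasOrientationOfWienerIndexNumEdges ↔ G.HasTransitiveOrientation := by
  refine exists_congr fun D => and_congr_right fun hD => ?_
  rw [← hD.numArcs_eq, Digraph.wienerIndex_eq_numArcs_iff hD.loopless]

/-! ### Forcing classes of arcs -/

namespace SimpleGraph

variable {V : Type*} (G : SimpleGraph V)

/-- Gallai's forcing relation on arcs: two arcs with a common tail whose heads are not adjacent,
or with a common head whose tails are not adjacent, belong to the same transitive orientations.
It is reflexive on arcs, since no vertex is adjacent to itself. -/
def Forces (e f : V × V) : Prop :=
  G.Adj e.1 e.2 ∧ G.Adj f.1 f.2 ∧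
    (e.1 = f.1 ∧ ¬ G.Adj e.2 f.2 ∨ e.2 = f.2 ∧ ¬ G.Adj e.1 f.1)

/-- The equivalence generated by `Forces`; its classes are the implication classes. -/
def ForcesStar (e f : V × V) : Prop :=
  Relation.ReflTransGen G.Forces e f

/-- Some implication class contains an arc together with the opposite arc. -/
def HasForcedConflict : Prop :=
  ∃ e : V × V, G.Adj e.1 e.2 ∧ G.ForcesStar e e.swap

variable {G}

theorem Forces.symm {e f : V × V} (h : G.Forces e f) : G.Forces f e :=
  ⟨h.2.1, h.1, h.2.2.imp (fun h => ⟨h.1.symm, fun h' => h.2 h'.symm⟩)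
    fun h => ⟨h.1.symm, fun h' => h.2 h'.symm⟩⟩

theorem Forces.swap {e f : V × V} (h : G.Forces e f) : G.Forces e.swap f.swap :=
  ⟨h.1.symm, h.2.1.symm, h.2.2.symm⟩

theorem ForcesStar.symm {e f : V × V} (h : G.ForcesStar e f) : G.ForcesStar f e := by
  induction h with
  | refl => exact .refl
  | tail _ h ih => exact ih.head h.symm

theorem ForcesStar.swap {e f : V × V} (h : G.ForcesStar e f) :
    G.ForcesStar e.swap f.swap := by
  induction h with
  | refl => exact .refl
  | tail _ h ih => exact ih.tail h.swap

theorem ForcesStar.trans {e f g : V × V} (h : G.ForcesStar e f) (h' : G.ForcesStar f g) :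
    G.ForcesStar e g :=
  Relation.ReflTransGen.trans h h'

theorem ForcesStar.adj {e f : V × V} (h : G.ForcesStar e f) (he : G.Adj e.1 e.2) :
    G.Adj f.1 f.2 := by
  induction h with
  | refl => exact he
  | tail _ h _ => exact h.2.1

/-- A transitive orientation contains with an arc its whole implication class. -/
theorem ForcesStar.adj_of_isTransitive {D : Digraph V} (hD : D.IsOrientationOf G)
    (ht : D.IsTransitive) {e f : V × V} (h : G.ForcesStar e f) (he : D.Adj e.1 e.2) :
    D.Adj f.1 f.2 := by
  rw [hD.isTransitive_iff] at ht
  induction h with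
  | refl => exact he
  | @tail f g _ h ih =>
    obtain ⟨f₁, f₂⟩ := f
    obtain ⟨g₁, g₂⟩ := g
    obtain ⟨-, hg, h⟩ := h
    refine ((hD.1 _ _).1 hg).resolve_right fun hg' => ?_
    dsimp only at *
    rcases h with ⟨rfl, h⟩ | ⟨rfl, h⟩
    · exact h ((hD.1 _ _).2 (Or.inr (ht _ _ _ hg' ih)))
    · exact h ((hD.1 _ _).2 (Or.inl (ht _ _ _ ih hg')))

theorem HasTransitiveOrientation.not_hasForcedConflict (h : G.HasTransitiveOrientation) :
    ¬ G.HasForcedConflict := by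
  obtain ⟨D, hD, ht⟩ := h
  rintro ⟨e, he, hee⟩
  rcases (hD.1 _ _).1 he with h | h
  · exact hD.2 _ _ ⟨h, hee.adj_of_isTransitive hD ht h⟩
  · exact hD.2 _ _ ⟨h, hee.symm.adj_of_isTransitive hD ht h⟩

/-- The triangle lemma: if the class of the side `bc` of a triangle `abc` contains neither `ba`
nor `ac`, then `a` forms a triangle with every arc of that class, and the classes of the other two
sides do not change. -/
theorem ForcesStar.triangle {a b c b' c' : V} (h : G.ForcesStar (b, c) (b', c'))
    (hab : G.Adj a b) (hac : G.Adj a c)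
    (h₁ : ¬ G.ForcesStar (b, c) (b, a)) (h₂ : ¬ G.ForcesStar (b, c) (a, c)) :
    G.ForcesStar (a, b) (a, b') ∧ G.ForcesStar (a, c) (a, c') := by
  suffices ∀ f, G.ForcesStar (b, c) f →
      G.ForcesStar (a, b) (a, f.1) ∧ G.ForcesStar (a, c) (a, f.2) from this _ h
  intro f hf
  induction hf with
  | refl => exact ⟨.refl, .refl⟩
  | @tail f g hf h ih =>
    obtain ⟨f₁, f₂⟩ := f
    obtain ⟨g₁, g₂⟩ := g
    obtain ⟨ih₁, ih₂⟩ := ih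
    have haf₁ : G.Adj a f₁ := ih₁.adj hab
    have haf₂ : G.Adj a f₂ := ih₂.adj hac
    have hf' : G.ForcesStar (b, c) (g₁, g₂) := hf.tail h
    obtain ⟨-, hg, h⟩ := h
    dsimp only at *
    rcases h with ⟨rfl, h⟩ | ⟨rfl, h⟩
    · refine ⟨ih₁, ?_⟩
      have hag : G.Adj a g₂ := by
        by_contra hag
        -- otherwise `f₁g₂` forces `f₁a`, which lies in the class of `ba`
        have hfo : G.Forces (f₁, g₂) (f₁, a) :=
          ⟨hg, haf₁.symm, Or.inl ⟨rfl, fun h => hag h.symm⟩⟩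
        exact h₁ ((hf'.tail hfo).trans ih₁.swap.symm)
      exact ih₂.tail ⟨haf₂, hag, Or.inl ⟨rfl, h⟩⟩
    · refine ⟨?_, ih₂⟩
      have hag : G.Adj a g₁ := by
        by_contra hag
        have hfo : G.Forces (g₁, f₂) (a, f₂) :=
          ⟨hg, haf₂, Or.inr ⟨rfl, fun h => hag h.symm⟩⟩
        exact h₂ ((hf'.tail hfo).trans ih₂.symm)
      exact ih₁.tail ⟨haf₁, hag, Or.inl ⟨rfl, h⟩⟩

/-! ### The lexicographic orientation -/

section Lexicographic

variable [LinearOrder V] [Finite V]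

theorem exists_min_forcesStar (G : SimpleGraph V) (e : V × V) :
    ∃ m, G.ForcesStar e m ∧ ∀ f, G.ForcesStar e f → toLex m ≤ toLex f := by
  obtain ⟨m, hm, hmin⟩ := Set.exists_min_image {f | G.ForcesStar e f} toLex (Set.toFinite _)
    ⟨e, .refl⟩
  exact ⟨m, hm, hmin⟩

/-- The lexicographically smallest arc in the implication class of an arc. -/
noncomputable def minArc (G : SimpleGraph V) (e : V × V) : V × V :=
  (G.exists_min_forcesStar e).choose

theorem forcesStar_minArc (G : SimpleGraph V) (e : V × V) : G.ForcesStar e (G.minArc e) :=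
  (G.exists_min_forcesStar e).choose_spec.1

theorem ForcesStar.minArc_le {e f : V × V} (h : G.ForcesStar e f) :
    toLex (G.minArc e) ≤ toLex f :=
  (G.exists_min_forcesStar e).choose_spec.2 f h

theorem ForcesStar.minArc_eq {e f : V × V} (h : G.ForcesStar e f) : G.minArc e = G.minArc f :=
  toLex.injective <| le_antisymm (h.trans (G.forcesStar_minArc f)).minArc_le
    (h.symm.trans (G.forcesStar_minArc e)).minArc_le

/-- The lexicographic orientation: of two opposite implication classes, take the one that contains
the lexicographically smaller arc. -/
def lexOrientation (G : SimpleGraph V) : Digraph V where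
  Adj u v := G.Adj u v ∧ toLex (G.minArc (u, v)) < toLex (G.minArc (v, u))

theorem ForcesStar.lexOrientation_adj {e f : V × V} (h : G.ForcesStar e f)
    (he : G.lexOrientation.Adj e.1 e.2) : G.lexOrientation.Adj f.1 f.2 := by
  refine ⟨h.adj he.1, ?_⟩
  have h₁ : G.minArc (e.1, e.2) = G.minArc (f.1, f.2) := h.minArc_eq
  have h₂ : G.minArc (e.2, e.1) = G.minArc (f.2, f.1) := h.swap.minArc_eq
  rw [← h₁, ← h₂]
  exact he.2

theorem lexOrientation_isOrientationOf (h : ¬ G.HasForcedConflict) :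
    G.lexOrientation.IsOrientationOf G := by
  refine ⟨fun u v => ⟨fun huv => ?_, fun huv => huv.elim (·.1) (·.1.symm)⟩,
    fun u v huv => lt_asymm huv.1.2 huv.2.2⟩
  rcases lt_trichotomy (toLex (G.minArc (u, v))) (toLex (G.minArc (v, u))) with hlt | heq | hlt
  · exact Or.inl ⟨huv, hlt⟩
  · refine absurd ⟨(u, v), huv, ?_⟩ h
    have := G.forcesStar_minArc (u, v)
    rw [toLex.injective heq] at this
    exact this.trans (G.forcesStar_minArc (v, u)).symm
  · exact Or.inr ⟨huv.symm, hlt⟩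

/-- The triangle lemma for a directed triangle of the lexicographic orientation. -/
theorem lexOrientation_triangle (h : ¬ G.HasForcedConflict) {a b c b' c' : V}
    (hab : G.lexOrientation.Adj a b) (hbc : G.lexOrientation.Adj b c)
    (hca : G.lexOrientation.Adj c a) (hf : G.ForcesStar (b, c) (b', c')) :
    G.ForcesStar (a, b) (a, b') ∧ G.ForcesStar (a, c) (a, c') := by
  have ho := lexOrientation_isOrientationOf h
  exact hf.triangle hab.1 hca.1.symm (fun h' => ho.2 _ _ ⟨hab, h'.lexOrientation_adj hbc⟩)
    fun h' => ho.2 _ _ ⟨hca, h'.lexOrientation_adj hbc⟩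

/-- The lexicographic choice excludes directed triangles. If the side `bc` of such a triangle is as
small as possible, minimality gives the smallest arc in the class of `ab` the tail `b`, so by the
triangle lemma `cb` is in the class of `ca`, and the edge `bc` would be directed both ways. -/
theorem lexOrientation_no_directed_triangle (h : ¬ G.HasForcedConflict) (a b c : V)
    (hab : G.lexOrientation.Adj a b) (hbc : G.lexOrientation.Adj b c)
    (hca : G.lexOrientation.Adj c a) : False := by
  -- pick a directed triangle `abc` whose side `bc` is lexicographically smallest
  let S : Set (V × V) := {e | ∃ a, G.lexOrientation.Adj a e.1 ∧ G.lexOrientation.Adj e.1 e.2 ∧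
    G.lexOrientation.Adj e.2 a}
  obtain ⟨⟨b, c⟩, ⟨a, hab, hbc, hca⟩, hmin⟩ :=
    Set.exists_min_image S toLex (Set.toFinite _) ⟨(b, c), a, hab, hbc, hca⟩
  dsimp only at hab hbc hca
  obtain ⟨⟨x, y⟩, hxy⟩ : ∃ m, G.minArc (a, b) = m := ⟨_, rfl⟩
  have hf : G.ForcesStar (a, b) (x, y) := hxy ▸ G.forcesStar_minArc (a, b)
  obtain ⟨h₁, h₂⟩ := lexOrientation_triangle h hca hab hbc hf
  -- the smallest arc `xy` of the class of `ab` also forms a directed triangle with `c`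
  have hle : toLex (b, c) ≤ toLex (x, y) :=
    hmin (x, y) ⟨c, h₁.lexOrientation_adj hca, hf.lexOrientation_adj hab,
      h₂.swap.lexOrientation_adj hbc⟩
  have hlt : toLex (x, y) < toLex (b, a) := by
    rw [← hxy]
    exact hab.2.trans_le (ForcesStar.minArc_le .refl)
  have hxb : x = b := by
    refine le_antisymm ?_ ?_
    · exact (Prod.Lex.toLex_le_toLex.1 hlt.le).elim (·.le) (·.1.le)
    · exact (Prod.Lex.toLex_le_toLex.1 hle).elim (·.le) (·.1.le)
  subst hxb
  exact (lexOrientation_isOrientationOf h).2 _ _ ⟨hbc, h₁.lexOrientation_adj hca⟩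

/-- A finite graph has a transitive orientation if and only if no implication class contains
opposite arcs. -/
theorem hasTransitiveOrientation_iff : G.HasTransitiveOrientation ↔ ¬ G.HasForcedConflict := by
  refine ⟨fun h => h.not_hasForcedConflict, fun h => ?_⟩
  have ho := lexOrientation_isOrientationOf h
  refine ⟨G.lexOrientation, ho, ho.isTransitive_iff.2 fun u v w huv hvw => ?_⟩
  have huw : G.Adj u w := by
    by_contra huw
    -- otherwise `uv` forces `wv`
    have hf : G.Forces (u, v) (w, v) := ⟨huv.1, hvw.1.symm, Or.inr ⟨rfl, huw⟩⟩
    have hs : G.ForcesStar (u, v) (w, v) := Relation.ReflTransGen.single hf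
    exact ho.2 _ _ ⟨hvw, hs.lexOrientation_adj huv⟩
  exact ((ho.1 u w).1 huw).resolve_right fun hwu =>
    lexOrientation_no_directed_triangle h u v w huv hvw hwu

end Lexicographic

end SimpleGraph

/-! ### Finite sets as bit strings -/

section BitSet

variable {α : Type*} {pos : α → ℕ}

/-- The number whose binary digits are the indicator of the set `S`, with the element `z` in
position `pos z`. -/
def bitSet (pos : α → ℕ) (S : Finset α) : ℕ :=
  ∑ z ∈ S, 2 ^ pos z

@[simp] theorem bitSet_empty : bitSet pos ∅ = 0 := rfl

@[simp] theorem bitSet_singleton (z : α) : bitSet pos {z} = 2 ^ pos z :=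
  Finset.sum_singleton _ _

@[simp] theorem bitSet_eq_zero {S : Finset α} : bitSet pos S = 0 ↔ S = ∅ := by
  simp [bitSet, Finset.eq_empty_iff_forall_notMem]

theorem testBit_bitSet (hpos : Function.Injective pos) (S : Finset α) (i : ℕ) :
    (bitSet pos S).testBit i = true ↔ ∃ z ∈ S, pos z = i := by
  classical
  have : bitSet pos S = ∑ j ∈ S.image pos, 2 ^ j := by
    rw [Finset.sum_image fun _ _ _ _ h => hpos h, bitSet]
  rw [this, ← Nat.mem_bitIndices, ← List.mem_toFinset, Finset.toFinset_bitIndices_sum_two_pow,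
    Finset.mem_image]

theorem bitSet_union [DecidableEq α] {S T : Finset α} (h : Disjoint S T) :
    bitSet pos (S ∪ T) = bitSet pos S + bitSet pos T :=
  Finset.sum_union h

theorem bitSet_sdiff [DecidableEq α] {S T : Finset α} (h : T ⊆ S) :
    bitSet pos (S \ T) = bitSet pos S - bitSet pos T := by
  have := Finset.sum_sdiff (f := fun z => 2 ^ pos z) h
  simp only [bitSet]
  omega

theorem bitSet_inter [DecidableEq α] (hpos : Function.Injective pos) (S T : Finset α) :
    bitSet pos (S ∩ T) = bitSet pos S &&& bitSet pos T := by
  refine Nat.eq_of_testBit_eq fun i => ?_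
  rw [Nat.testBit_and, Bool.eq_iff_iff, Bool.and_eq_true, testBit_bitSet hpos,
    testBit_bitSet hpos, testBit_bitSet hpos]
  constructor
  · rintro ⟨z, hz, rfl⟩
    rw [Finset.mem_inter] at hz
    exact ⟨⟨z, hz.1, rfl⟩, z, hz.2, rfl⟩
  · rintro ⟨⟨z, hz, rfl⟩, w, hw, hwz⟩
    obtain rfl := hpos hwz
    exact ⟨w, Finset.mem_inter.2 ⟨hz, hw⟩, rfl⟩

theorem bitSet_sdiff_inter [DecidableEq α] (hpos : Function.Injective pos) (S T : Finset α) :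
    bitSet pos (S \ T) = bitSet pos S - (bitSet pos S &&& bitSet pos T) := by
  rw [← bitSet_inter hpos, ← bitSet_sdiff Finset.inter_subset_left, Finset.sdiff_inter_self_left]

theorem two_pow_and_two_pow (i j : ℕ) : 2 ^ i &&& 2 ^ j = if i = j then 2 ^ i else 0 := by
  have := bitSet_inter (pos := id) Function.injective_id {i} {j}
  simp only [bitSet_singleton, id] at this
  rw [← this, Finset.singleton_inter]
  simp only [Finset.mem_singleton]
  split_ifs <;> simp

/-- Subtracting `1` from a number clears its lowest binary digit `1` and sets all digits below,
so `w - (w &&& (w - 1))` is the power of two at the lowest digit. -/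
theorem exists_lowest_bit (hpos : Function.Injective pos) {S : Finset α} (hS : S.Nonempty) :
    ∃ z ∈ S, bitSet pos S - (bitSet pos S &&& (bitSet pos S - 1)) = 2 ^ pos z := by
  obtain ⟨z, hz, hmin⟩ := S.exists_min_image pos hS
  refine ⟨z, hz, ?_⟩
  let T : Finset ℕ := S.image pos
  have hT : bitSet pos S = bitSet id T := by
    simp only [bitSet, T, id]
    rw [Finset.sum_image fun _ _ _ _ h => hpos h]
  have hzT : pos z ∈ T := Finset.mem_image_of_mem _ hz
  have hle : ∀ i ∈ T, pos z ≤ i := by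
    intro i hi
    obtain ⟨w, hw, rfl⟩ := Finset.mem_image.1 hi
    exact hmin w hw
  have h₁ : bitSet id T = bitSet id (T.erase (pos z)) + 2 ^ pos z := by
    rw [bitSet, ← Finset.sum_erase_add _ _ hzT]
    rfl
  have h₂ : bitSet id (Finset.range (pos z)) = 2 ^ pos z - 1 := by
    simp only [bitSet, id]
    exact Nat.geomSum_eq (le_refl 2) _ |>.trans (by simp)
  have hdisj : Disjoint (T.erase (pos z)) (Finset.range (pos z)) := by
    rw [Finset.disjoint_left]
    intro i hi hi'
    have := hle i (Finset.mem_of_mem_erase hi)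
    have := Finset.mem_range.1 hi'
    omega
  have h₃ : bitSet id T - 1 = bitSet id (T.erase (pos z) ∪ Finset.range (pos z)) := by
    rw [bitSet_union hdisj, h₂, h₁]
    have := Nat.one_le_two_pow (n := pos z)
    omega
  have h₄ : T ∩ (T.erase (pos z) ∪ Finset.range (pos z)) = T.erase (pos z) := by
    ext i
    simp only [Finset.mem_inter, Finset.mem_union, Finset.mem_erase, Finset.mem_range]
    constructor
    · rintro ⟨hi, h | h⟩
      · exact h
      · have := hle i hi
        omega
    · exact fun h => ⟨h.2, Or.inl h⟩
  rw [hT, h₃, ← bitSet_inter Function.injective_id, h₄, h₁]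
  exact Nat.add_sub_cancel_left _ _

end BitSet

/-! ### Exploring the classes of a symmetric relation -/

section Explore

variable {α : Type*} [DecidableEq α]

/-- The state of a search that explores the classes generated by a relation `r` on the set `E`,
one class after the other: `R` holds the elements that have not been reached, `W` those that have
been reached but not yet expanded, `e` is the element at which the current class was entered, and
`R₀` is the value of `R` before that. The flag `ok` says that so far no class has been found to
contain an element together with its image under `σ`; within the current class only the
image of `e` is looked for. -/
structure Exploring (r : α → α → Prop) (σ : α → α) (E R₀ R W : Finset α) (e : α) (ok : Prop) :
    Prop where
  subset_E : R₀ ⊆ E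
  start_mem : e ∈ R₀
  start_notMem : e ∉ R
  subset : R ⊆ R₀
  frontier_subset : W ⊆ R₀ \ R
  closed : ∀ y ∈ R₀, ∀ z, r y z → z ∈ R₀
  reached : ∀ y ∈ R₀ \ R, Relation.ReflTransGen r e y
  expanded : ∀ y ∈ (R₀ \ R) \ W, ∀ z, r y z → z ∉ R
  ok_iff : ok ↔ (∀ y ∈ E \ R₀, ¬ Relation.ReflTransGen r y (σ y)) ∧ σ e ∉ (R₀ \ R) \ W

/-- The state between two classes of the search described at `Exploring`. -/
structure Explored (r : α → α → Prop) (σ : α → α) (E R : Finset α) (ok : Prop) : Prop where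
  subset_E : R ⊆ E
  closed : ∀ y ∈ R, ∀ z, r y z → z ∈ R
  ok_iff : ok ↔ ∀ y ∈ E \ R, ¬ Relation.ReflTransGen r y (σ y)

variable {r : α → α → Prop} {σ : α → α} {E R₀ R W : Finset α} {e x : α} {ok : Prop}

theorem Explored.start (h : Explored r σ E R ok) (he : e ∈ R) :
    Exploring r σ E R (R \ {e}) {e} e ok where
  subset_E := h.subset_E
  start_mem := he
  start_notMem := by simp
  subset := Finset.sdiff_subset
  frontier_subset := by simpa using he
  closed := h.closed
  reached y hy := by
    have : y = e := by
      simp only [Finset.mem_sdiff, Finset.mem_singleton] at hy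
      tauto
    exact this ▸ .refl
  expanded y hy := by
    simp only [Finset.mem_sdiff, Finset.mem_singleton] at hy
    tauto
  ok_iff := by
    rw [h.ok_iff, iff_self_and]
    simp only [Finset.mem_sdiff, Finset.mem_singleton]
    tauto

/-- When the frontier is empty, the elements reached since `e` was entered are exactly the class of
`e`. Since `r` is invariant under `σ`, either all elements of a class are equivalent to their
images under `σ` or none is, so it was enough to look for `σ e`. -/
theorem Exploring.finish (hr : ∀ y z, r y z → r z y) (hσ : ∀ y z, r y z → r (σ y) (σ z))
    (h : Exploring r σ E R₀ R ∅ e ok) : Explored r σ E R ok := by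
  have hs : ∀ {y z}, Relation.ReflTransGen r y z → Relation.ReflTransGen r z y := by
    intro y z hyz
    induction hyz with
    | refl => exact .refl
    | tail _ h ih => exact ih.head (hr _ _ h)
  have hσs : ∀ {y z}, Relation.ReflTransGen r y z → Relation.ReflTransGen r (σ y) (σ z) := by
    intro y z hyz
    induction hyz with
    | refl => exact .refl
    | tail _ h ih => exact ih.tail (hσ _ _ h)
  have hexp : ∀ y ∈ R₀, y ∉ R → ∀ z, r y z → z ∈ R₀ ∧ z ∉ R := fun y hy hyR z hz =>
    ⟨h.closed y hy z hz, h.expanded y (by simp [hy, hyR]) z hz⟩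
  have hclass : ∀ z, Relation.ReflTransGen r e z → z ∈ R₀ \ R := by
    intro z hz
    rw [Finset.mem_sdiff]
    induction hz with
    | refl => exact ⟨h.start_mem, h.start_notMem⟩
    | tail _ hyz ih => exact hexp _ ih.1 ih.2 _ hyz
  refine ⟨h.subset.trans h.subset_E, fun y hy z hyz => ?_, ?_⟩
  · by_contra hz
    exact (hexp z (h.closed y (h.subset hy) z hyz) hz y (hr _ _ hyz)).2 hy
  · rw [h.ok_iff, Finset.sdiff_empty]
    constructor
    · rintro ⟨h₁, h₂⟩ y hy hbad
      rw [Finset.mem_sdiff] at hy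
      by_cases hy₀ : y ∈ R₀
      · have hey := h.reached y (Finset.mem_sdiff.2 ⟨hy₀, hy.2⟩)
        exact h₂ (hclass _ ((hey.trans hbad).trans (hσs (hs hey))))
      · exact h₁ y (Finset.mem_sdiff.2 ⟨hy.1, hy₀⟩) hbad
    · refine fun h' => ⟨fun y hy => ?_, fun hmem => ?_⟩
      · rw [Finset.mem_sdiff] at hy
        exact h' y (Finset.mem_sdiff.2 ⟨hy.1, fun hyR => hy.2 (h.subset hyR)⟩)
      · exact h' e (Finset.mem_sdiff.2 ⟨h.subset_E h.start_mem, h.start_notMem⟩) (h.reached _ hmem)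

/-- Expanding `x` moves the elements of `R` that are related to `x` into the frontier. -/
theorem Exploring.expand {R' : Finset α} (h : Exploring r σ E R₀ R W e ok) (hx : x ∈ W)
    (hR' : R' ⊆ R) (hmem : ∀ z ∈ R, z ∈ R' ↔ ¬ r x z) :
    Exploring r σ E R₀ R' (W \ {x} ∪ R \ R') e (ok ∧ x ≠ σ e) where
  subset_E := h.subset_E
  start_mem := h.start_mem
  start_notMem he := h.start_notMem (hR' he)
  subset := hR'.trans h.subset
  frontier_subset y hy := by
    rw [Finset.mem_sdiff]
    simp only [Finset.mem_union, Finset.mem_sdiff] at hy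
    rcases hy with hy | hy
    · have := Finset.mem_sdiff.1 (h.frontier_subset hy.1)
      exact ⟨this.1, fun h' => this.2 (hR' h')⟩
    · exact ⟨h.subset hy.1, hy.2⟩
  closed := h.closed
  reached y hy := by
    rw [Finset.mem_sdiff] at hy
    by_cases hyR : y ∈ R
    · have hxy : r x y := not_not.1 fun h' => hy.2 ((hmem y hyR).2 h')
      exact (h.reached x (h.frontier_subset hx)).tail hxy
    · exact h.reached y (Finset.mem_sdiff.2 ⟨hy.1, hyR⟩)
  expanded y hy z hyz hz := by
    simp only [Finset.mem_sdiff, Finset.mem_union, Finset.mem_singleton, not_or, not_and,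
      not_not] at hy
    have hyR : y ∉ R := fun h' => hy.1.2 (hy.2.2 h')
    by_cases hyW : y ∈ W
    · obtain rfl := hy.2.1 hyW
      exact (hmem z (hR' hz)).1 hz hyz
    · exact h.expanded y (by simp [hy.1.1, hyR, hyW]) z hyz (hR' hz)
  ok_iff := by
    rw [h.ok_iff, and_assoc, and_congr_right_iff]
    intro _
    have hx' := Finset.mem_sdiff.1 (h.frontier_subset hx)
    simp only [Finset.mem_sdiff, Finset.mem_union, Finset.mem_singleton]
    constructor
    · rintro ⟨h₁, h₂⟩ ⟨⟨h₃, h₄⟩, h₅⟩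
      by_cases hR : σ e ∈ R
      · tauto
      · by_cases hW : σ e ∈ W
        · exact h₅ (Or.inl ⟨hW, fun h => h₂ h.symm⟩)
        · tauto
    · intro h₁
      refine ⟨fun h₂ => h₁ ⟨⟨h₂.1.1, fun h' => h₂.1.2 (hR' h')⟩, ?_⟩, ?_⟩
      · tauto
      · rintro rfl
        exact h₁ ⟨⟨hx'.1, fun h' => hx'.2 (hR' h')⟩, by tauto⟩

end Explore

/-! ### A structured language for random access machines -/

namespace RAM

/-- The variables of the decision procedure: the order `n` of the graph and its square `size`, the
index `p` of the pair `(a, b)` of vertices that is being dealt with, the number `x` that encodes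
this pair, the sets `rest` of arcs that have not been reached and `front` of arcs that have been
reached but not expanded, the reverse `rev` of the arc at which the current implication class was
entered, a number `bad` that is not zero once `rev` has been met in that class, and the set `new` of
arcs about to be moved from `rest` to `front`. -/
inductive Var where
  | n | size | p | a | b | x | rest | front | rev | bad | new
  deriving DecidableEq

/-- The register that holds a variable. Register `0`, which holds the order of the graph at the
start and the answer at the end, belongs to `n`. -/
def Var.reg : Var → ℕ
  | n => 0 | size => 1 | p => 2 | a => 3 | b => 4 | x => 5 | rest => 6 | front => 7 | rev => 8
  | bad => 9 | new => 10

/-- The first of the registers that hold intermediate results. -/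
def tempReg : ℕ := 11

theorem Var.reg_lt (v : Var) : v.reg < tempReg := by
  cases v <;> decide

theorem Var.reg_injective : Function.Injective Var.reg := by
  intro v w h
  cases v <;> cases w <;> first | rfl | exact absurd h (by decide)

/-- The values of the variables and the memory. -/
structure Store where
  var : Var → ℕ
  mem : ℕ → ℕ

namespace Store

def set (σ : Store) (v : Var) (k : ℕ) : Store := ⟨Function.update σ.var v k, σ.mem⟩

def write (σ : Store) (i k : ℕ) : Store := ⟨σ.var, Function.update σ.mem i k⟩

@[simp] theorem var_set (σ : Store) (v w : Var) (k : ℕ) :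
    (σ.set v k).var w = if w = v then k else σ.var w :=
  Function.update_apply ..

@[simp] theorem mem_set (σ : Store) (v : Var) (k : ℕ) : (σ.set v k).mem = σ.mem := rfl

@[simp] theorem var_write (σ : Store) (i k : ℕ) : (σ.write i k).var = σ.var := rfl

theorem mem_write (σ : Store) (i j k : ℕ) :
    (σ.write i k).mem j = if j = i then k else σ.mem j :=
  Function.update_apply ..

end Store

/-- Expressions, built from the operations that the machine offers. -/
inductive Expr where
  | lit (c : ℕ)
  | var (v : Var)
  | add (e f : Expr)
  | sub (e f : Expr)
  | band (e f : Expr)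
  /-- twice the value of an expression -/
  | double (e : Expr)
  /-- the memory cell at the given address -/
  | mem (e : Expr)

namespace Expr

def eval (σ : Store) : Expr → ℕ
  | lit c => c
  | var v => σ.var v
  | add e f => e.eval σ + f.eval σ
  | sub e f => e.eval σ - f.eval σ
  | band e f => e.eval σ &&& f.eval σ
  | double e => e.eval σ + e.eval σ
  | mem e => σ.mem (e.eval σ)

/-- Instructions that put the value of an expression into register `t`, using the registers from
`t` on as a stack of intermediate results. -/
def compile : Expr → ℕ → List Instr
  | lit c, t => [.const t c]
  | var v, t => [.const t 0, .add t t v.reg]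
  | add e f, t => e.compile t ++ f.compile (t + 1) ++ [.add t t (t + 1)]
  | sub e f, t => e.compile t ++ f.compile (t + 1) ++ [.sub t t (t + 1)]
  | band e f, t => e.compile t ++ f.compile (t + 1) ++ [.band t t (t + 1)]
  | double e, t => e.compile t ++ [.add t t t]
  | mem e, t => e.compile t ++ [.load t t]

end Expr

/-- Structured commands. Their code is obtained by `Cmd.compile`. -/
inductive Cmd where
  | skip
  | assign (v : Var) (e : Expr)
  /-- put the value of `f` into the memory cell whose address is the value of `e` -/
  | store (e f : Expr)
  | seq (c d : Cmd)
  /-- execute `c` if the value of `e` is not zero, and `d` if it is -/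
  | ite (e : Expr) (c d : Cmd)
  /-- execute `c` as long as the value of `e` is not zero -/
  | loop (e : Expr) (c : Cmd)

namespace Cmd

/-- The number of instructions in the compiled command. -/
def size : Cmd → ℕ
  | skip => 0
  | assign _ e => (e.compile tempReg).length + 2
  | store e f => (e.compile tempReg).length + (f.compile (tempReg + 1)).length + 1
  | seq c d => c.size + d.size
  | ite e c d => (e.compile tempReg).length + 1 + c.size + 1 + d.size
  | loop e c => (e.compile tempReg).length + 1 + c.size + 1

/-- Machine code for a command, to be placed at position `l` of a program. -/
def compile : Cmd → ℕ → List Instr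
  | skip, _ => []
  | assign v e, _ => e.compile tempReg ++ [.const v.reg 0, .add v.reg v.reg tempReg]
  | store e f, _ => e.compile tempReg ++ f.compile (tempReg + 1) ++ [.store tempReg (tempReg + 1)]
  | seq c d, l => c.compile l ++ d.compile (l + c.size)
  | ite e c d, l =>
      let l₁ := l + (e.compile tempReg).length + 1
      let l₂ := l₁ + c.size + 1
      e.compile tempReg ++ [.jumpZero tempReg l₂] ++ c.compile l₁ ++ [.jump (l₂ + d.size)] ++
        d.compile l₂
  | loop e c, l =>
      let l₁ := l + (e.compile tempReg).length + 1
      e.compile tempReg ++ [.jumpZero tempReg (l₁ + c.size + 1)] ++ c.compile l₁ ++ [.jump l]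

theorem length_compile (c : Cmd) (l : ℕ) : (c.compile l).length = c.size := by
  induction c generalizing l with
  | skip => rfl
  | assign v e => simp [compile, size]
  | store e f => simp [compile, size]; omega
  | seq c d hc hd => simp [compile, size, hc, hd]
  | ite e c d hc hd => simp [compile, size, hc, hd]; omega
  | loop e c hc => simp [compile, size, hc]; omega

end Cmd

/-! ### Execution of compiled code -/

/-- The program `P` contains the instructions `L` from position `l` on. -/
def CodeAt (P : Program) (l : ℕ) (L : List Instr) : Prop :=
  L <+: P.drop l

theorem CodeAt.left {P : Program} {l : ℕ} {L M : List Instr} (h : CodeAt P l (L ++ M)) :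
    CodeAt P l L :=
  (List.prefix_append L M).trans h

theorem CodeAt.right {P : Program} {l : ℕ} {L M : List Instr} (h : CodeAt P l (L ++ M)) :
    CodeAt P (l + L.length) M := by
  obtain ⟨K, hK⟩ := h
  refine ⟨K, ?_⟩
  rw [← List.drop_drop, ← hK, List.append_assoc, List.drop_left]

theorem CodeAt.step {P : Program} {s : State} {i : Instr} {L : List Instr}
    (h : CodeAt P s.pc (i :: L)) : RAM.step P s = i.exec s := by
  obtain ⟨K, hK⟩ := h
  have : P[s.pc]? = some i := by
    have := congrArg (·[0]?) hK
    simpa using this.symm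
  simp [RAM.step, this]

theorem iterate_step_trans {P : Program} {s s' s'' : State} {t t' : ℕ}
    (h : (step P)^[t] s = s') (h' : (step P)^[t'] s' = s'') : (step P)^[t + t'] s = s'' := by
  rw [add_comm, Function.iterate_add_apply, h, h']

theorem iterate_step_snoc {P : Program} {s s' : State} {t l : ℕ} {i : Instr}
    (h : (step P)^[t] s = s') (hl : s'.pc = l) (hc : CodeAt P l [i]) :
    (step P)^[t + 1] s = i.exec s' := by
  subst hl
  rw [add_comm, Function.iterate_add_apply, h, Function.iterate_one, hc.step]

/-- The machine state `s` holds the values of the store `σ`. -/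
structure Represents (σ : Store) (s : State) : Prop where
  reg : ∀ v : Var, s.reg v.reg = σ.var v
  mem : s.mem = σ.mem

theorem Represents.of_reg_eq {σ : Store} {s s' : State} (h : Represents σ s)
    (hr : ∀ i < tempReg, s'.reg i = s.reg i) (hm : s'.mem = s.mem) : Represents σ s' :=
  ⟨fun v => (hr _ v.reg_lt).trans (h.reg v), hm.trans h.mem⟩

/-- Compiled expressions are correct: the value ends up in register `t`, and the memory and the
registers below `t` do not change. -/
theorem Expr.exists_iterate_step (P : Program) (σ : Store) (e : Expr) (t : ℕ) (s : State)
    (ht : tempReg ≤ t) (hs : Represents σ s) (hc : CodeAt P s.pc (e.compile t)) :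
    ∃ s', (step P)^[(e.compile t).length] s = s' ∧ s'.pc = s.pc + (e.compile t).length ∧
      s'.mem = s.mem ∧ s'.reg t = e.eval σ ∧ ∀ i < t, s'.reg i = s.reg i := by
  have binary : ∀ (e f : Expr) (g : Instr) (k : ℕ),
      (∀ t s, tempReg ≤ t → Represents σ s → CodeAt P s.pc (e.compile t) →
        ∃ s', (step P)^[(e.compile t).length] s = s' ∧ s'.pc = s.pc + (e.compile t).length ∧
          s'.mem = s.mem ∧ s'.reg t = e.eval σ ∧ ∀ i < t, s'.reg i = s.reg i) →
      (∀ t s, tempReg ≤ t → Represents σ s → CodeAt P s.pc (f.compile t) →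
        ∃ s', (step P)^[(f.compile t).length] s = s' ∧ s'.pc = s.pc + (f.compile t).length ∧
          s'.mem = s.mem ∧ s'.reg t = f.eval σ ∧ ∀ i < t, s'.reg i = s.reg i) →
      ∀ (t : ℕ) (s : State), tempReg ≤ t → Represents σ s →
      CodeAt P s.pc (e.compile t ++ f.compile (t + 1) ++ [g]) →
      (∀ s : State, s.reg t = e.eval σ → s.reg (t + 1) = f.eval σ →
        g.exec s = ⟨s.pc + 1, Function.update s.reg t k, s.mem⟩) →
      ∃ s', (step P)^[(e.compile t ++ f.compile (t + 1) ++ [g]).length] s = s' ∧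
        s'.pc = s.pc + (e.compile t ++ f.compile (t + 1) ++ [g]).length ∧
        s'.mem = s.mem ∧ s'.reg t = k ∧ ∀ i < t, s'.reg i = s.reg i := by
    intro e f g k he hf t s ht hs hc hg
    obtain ⟨s₁, h₁, hpc₁, hm₁, ht₁, hr₁⟩ := he t s ht hs hc.left.left
    have hs₁ := hs.of_reg_eq (fun i hi => hr₁ i (by omega)) hm₁
    obtain ⟨s₂, h₂, hpc₂, hm₂, ht₂, hr₂⟩ := hf (t + 1) s₁ (by omega) hs₁ (hpc₁ ▸ hc.left.right)
    have hc' := hc.right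
    rw [List.length_append] at hc'
    have h₃ := iterate_step_snoc (iterate_step_trans h₁ h₂) (by rw [hpc₂, hpc₁, add_assoc]) hc'
    rw [hg s₂ ((hr₂ t (by omega)).trans ht₁) ht₂] at h₃
    refine ⟨⟨s₂.pc + 1, Function.update s₂.reg t k, s₂.mem⟩, ?_, ?_, hm₂.trans hm₁, by simp,
      fun i hi => ?_⟩
    · rw [List.length_append, List.length_append, List.length_singleton, h₃]
    · simp only [hpc₂, hpc₁, List.length_append, List.length_singleton]
      omega
    · simp only [Function.update_of_ne hi.ne]
      rw [hr₂ i (by omega), hr₁ i hi]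
  have unary : ∀ (e : Expr) (g : Instr) (k : ℕ),
      (∀ t s, tempReg ≤ t → Represents σ s → CodeAt P s.pc (e.compile t) →
        ∃ s', (step P)^[(e.compile t).length] s = s' ∧ s'.pc = s.pc + (e.compile t).length ∧
          s'.mem = s.mem ∧ s'.reg t = e.eval σ ∧ ∀ i < t, s'.reg i = s.reg i) →
      ∀ (t : ℕ) (s : State), tempReg ≤ t → Represents σ s →
      CodeAt P s.pc (e.compile t ++ [g]) →
      (∀ s : State, s.reg t = e.eval σ → s.mem = σ.mem →
        g.exec s = ⟨s.pc + 1, Function.update s.reg t k, s.mem⟩) →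
      ∃ s', (step P)^[(e.compile t ++ [g]).length] s = s' ∧
        s'.pc = s.pc + (e.compile t ++ [g]).length ∧
        s'.mem = s.mem ∧ s'.reg t = k ∧ ∀ i < t, s'.reg i = s.reg i := by
    intro e g k he t s ht hs hc hg
    obtain ⟨s₁, h₁, hpc₁, hm₁, ht₁, hr₁⟩ := he t s ht hs hc.left
    have h₃ := iterate_step_snoc h₁ hpc₁ hc.right
    rw [hg s₁ ht₁ (hm₁.trans hs.mem)] at h₃
    refine ⟨⟨s₁.pc + 1, Function.update s₁.reg t k, s₁.mem⟩, ?_, ?_, hm₁, by simp,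
      fun i hi => ?_⟩
    · rw [List.length_append, List.length_singleton, h₃]
    · simp only [hpc₁, List.length_append, List.length_singleton]
      omega
    · simp only [Function.update_of_ne hi.ne]
      rw [hr₁ i hi]
  induction e generalizing t s with
  | lit c =>
    have h : (step P)^[1] s = _ := hc.step
    exact ⟨_, h, rfl, rfl, by simp [Instr.exec, eval], fun i hi => by
      simp [Instr.exec, Function.update_of_ne hi.ne]⟩
  | var v =>
    have h : (step P)^[1] s = _ := hc.step
    have hv := v.reg_lt
    have h₂ := iterate_step_snoc h (l := s.pc + 1) rfl
      (CodeAt.right (L := [.const t 0]) (M := [.add t t v.reg]) hc)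
    refine ⟨_, h₂, rfl, rfl, ?_, fun i hi => ?_⟩
    · have : v.reg ≠ t := by omega
      simp [Instr.exec, eval, Function.update_of_ne this, hs.reg]
    · simp [Instr.exec, Function.update_of_ne hi.ne]
  | add e f he hf =>
    refine binary e f _ _ he hf t s ht hs hc fun s h h' => ?_
    rw [Instr.exec, h, h', eval]
  | sub e f he hf =>
    refine binary e f _ _ he hf t s ht hs hc fun s h h' => ?_
    rw [Instr.exec, h, h', eval]
  | band e f he hf =>
    refine binary e f _ _ he hf t s ht hs hc fun s h h' => ?_
    rw [Instr.exec, h, h', eval]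
  | double e he =>
    refine unary e _ _ he t s ht hs hc fun s h _ => ?_
    rw [Instr.exec, h, eval]
  | mem e he =>
    refine unary e _ _ he t s ht hs hc fun s h h' => ?_
    rw [Instr.exec, h, h', eval]

namespace Cmd

/-- Compiled code of the command `c`, wherever it is placed, turns the store `σ` into `σ'` in
exactly `t` steps, after which the machine is at the end of that code. -/
def Runs (c : Cmd) (σ σ' : Store) (t : ℕ) : Prop :=
  ∀ (P : Program) (s : State), Represents σ s → CodeAt P s.pc (c.compile s.pc) →
    ((step P)^[t] s).pc = s.pc + c.size ∧ Represents σ' ((step P)^[t] s)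

theorem runs_skip (σ : Store) : skip.Runs σ σ skip.size :=
  fun _ _ hs _ => ⟨rfl, hs⟩

theorem runs_assign (v : Var) (e : Expr) (σ : Store) :
    (assign v e).Runs σ (σ.set v (e.eval σ)) (assign v e).size := by
  intro P s hs hc
  obtain ⟨s₁, h₁, hpc₁, hm₁, ht₁, hr₁⟩ := e.exists_iterate_step P σ tempReg s le_rfl hs hc.left
  have hc' := hc.right
  have h₂ := iterate_step_snoc h₁ hpc₁
    (CodeAt.left (L := [.const v.reg 0]) (M := [.add v.reg v.reg tempReg]) hc')
  have h₃ := iterate_step_snoc h₂ (by simp [Instr.exec, hpc₁])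
    (CodeAt.right (L := [.const v.reg 0]) (M := [.add v.reg v.reg tempReg]) hc')
  rw [size, h₃]
  have hne : tempReg ≠ v.reg := v.reg_lt.ne'
  refine ⟨by simp [Instr.exec, hpc₁]; omega, fun w => ?_, by simp [Instr.exec, hm₁, hs.mem]⟩
  by_cases hw : w = v
  · subst hw
    simp [Instr.exec, Function.update_of_ne hne, ht₁]
  · have : w.reg ≠ v.reg := fun h => hw (Var.reg_injective h)
    simp [Instr.exec, Function.update_of_ne this, hw, hr₁ _ w.reg_lt, hs.reg]

theorem runs_store (e f : Expr) (σ : Store) :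
    (store e f).Runs σ (σ.write (e.eval σ) (f.eval σ)) (store e f).size := by
  intro P s hs hc
  obtain ⟨s₁, h₁, hpc₁, hm₁, ht₁, hr₁⟩ :=
    e.exists_iterate_step P σ tempReg s le_rfl hs hc.left.left
  have hs₁ := hs.of_reg_eq hr₁ hm₁
  obtain ⟨s₂, h₂, hpc₂, hm₂, ht₂, hr₂⟩ := f.exists_iterate_step P σ (tempReg + 1) s₁ (by omega) hs₁
    (hpc₁ ▸ hc.left.right)
  have hs₂ := hs₁.of_reg_eq (fun i hi => hr₂ i (by omega)) hm₂
  have hc' := hc.right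
  rw [List.length_append] at hc'
  have h₃ := iterate_step_snoc (iterate_step_trans h₁ h₂) (by rw [hpc₂, hpc₁, add_assoc]) hc'
  rw [size, h₃]
  refine ⟨by simp [Instr.exec, hpc₁, hpc₂]; omega, fun w => hs₂.reg w, ?_⟩
  simp [Instr.exec, Store.write, ht₂, hr₂ tempReg (by omega), ht₁, hs₂.mem]

theorem Runs.seq {c d : Cmd} {σ σ' σ'' : Store} {t t' : ℕ} (hc : c.Runs σ σ' t)
    (hd : d.Runs σ' σ'' t') : (seq c d).Runs σ σ'' (t + t') := by
  intro P s hs h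
  obtain ⟨hpc, hs'⟩ := hc P s hs h.left
  have h' := h.right
  rw [length_compile, ← hpc] at h'
  obtain ⟨hpc', hs''⟩ := hd P _ hs' h'
  rw [iterate_step_trans rfl rfl]
  exact ⟨by rw [hpc', hpc, size, add_assoc], hs''⟩

/-- The evaluation of a condition and the conditional jump that follows it. -/
theorem exists_iterate_step_jumpZero {P : Program} {σ : Store} {e : Expr} {s : State} {l : ℕ}
    (hs : Represents σ s)
    (hc : CodeAt P s.pc (e.compile tempReg ++ [.jumpZero tempReg l])) :
    ∃ s', (step P)^[(e.compile tempReg).length + 1] s = s' ∧ Represents σ s' ∧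
      s'.pc = if e.eval σ = 0 then l else s.pc + (e.compile tempReg).length + 1 := by
  obtain ⟨s₁, h₁, hpc₁, hm₁, ht₁, hr₁⟩ := e.exists_iterate_step P σ tempReg s le_rfl hs hc.left
  refine ⟨_, iterate_step_snoc h₁ hpc₁ hc.right, (hs.of_reg_eq hr₁ hm₁ : Represents σ s₁).of_reg_eq
    (fun _ _ => rfl) rfl, ?_⟩
  simp [Instr.exec, ht₁, hpc₁]

theorem Runs.ite_of_ne {e : Expr} {c d : Cmd} {σ σ' : Store} {t : ℕ} (he : e.eval σ ≠ 0)
    (hc : c.Runs σ σ' t) :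
    (ite e c d).Runs σ σ' ((e.compile tempReg).length + 1 + t + 1) := by
  intro P s hs h
  obtain ⟨s₁, h₁, hs₁, hpc₁⟩ := exists_iterate_step_jumpZero hs h.left.left.left
  rw [if_neg he] at hpc₁
  have h' := h.left.left.right
  rw [List.length_append, List.length_singleton, ← add_assoc, ← hpc₁] at h'
  obtain ⟨hpc₂, hs₂⟩ := hc P s₁ hs₁ (hpc₁ ▸ h')
  have h'' := h.left.right
  rw [iterate_step_snoc (iterate_step_trans h₁ rfl) (by simp [hpc₂, hpc₁, length_compile]; omega)
    h'']
  exact ⟨by simp [Instr.exec, size]; omega, hs₂.of_reg_eq (fun _ _ => rfl) rfl⟩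

theorem Runs.ite_of_eq {e : Expr} {c d : Cmd} {σ σ' : Store} {t : ℕ} (he : e.eval σ = 0)
    (hd : d.Runs σ σ' t) :
    (ite e c d).Runs σ σ' ((e.compile tempReg).length + 1 + t) := by
  intro P s hs h
  obtain ⟨s₁, h₁, hs₁, hpc₁⟩ := exists_iterate_step_jumpZero hs h.left.left.left
  rw [if_pos he] at hpc₁
  have h' := h.right
  simp only [List.length_append, List.length_singleton, length_compile, ← add_assoc] at h'
  rw [← hpc₁] at h'
  obtain ⟨hpc₂, hs₂⟩ := hd P s₁ hs₁ (by rwa [hpc₁] at h' ⊢)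
  rw [iterate_step_trans h₁ rfl]
  exact ⟨by simp [hpc₂, hpc₁, size]; omega, hs₂⟩

theorem Runs.loop_of_eq {e : Expr} {c : Cmd} {σ : Store} (he : e.eval σ = 0) :
    (Cmd.loop e c).Runs σ σ ((e.compile tempReg).length + 1) := by
  intro P s hs h
  obtain ⟨s₁, h₁, hs₁, hpc₁⟩ := exists_iterate_step_jumpZero hs h.left.left
  rw [h₁, hpc₁, if_pos he]
  exact ⟨by simp [size]; omega, hs₁⟩

theorem Runs.loop_of_ne {e : Expr} {c : Cmd} {σ σ' σ'' : Store} {t t' : ℕ}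
    (he : e.eval σ ≠ 0) (hc : c.Runs σ σ' t) (hw : (Cmd.loop e c).Runs σ' σ'' t') :
    (Cmd.loop e c).Runs σ σ'' ((e.compile tempReg).length + 1 + t + 1 + t') := by
  intro P s hs h
  obtain ⟨s₁, h₁, hs₁, hpc₁⟩ := exists_iterate_step_jumpZero hs h.left.left
  rw [if_neg he] at hpc₁
  have h' := h.left.right
  rw [List.length_append, List.length_singleton, ← add_assoc, ← hpc₁] at h'
  obtain ⟨hpc₂, hs₂⟩ := hc P s₁ hs₁ (hpc₁ ▸ h')
  have h₃ := iterate_step_snoc (iterate_step_trans h₁ (t' := t) rfl)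
    (by simp [hpc₂, hpc₁, length_compile]; omega) h.right
  rw [iterate_step_trans h₃ rfl]
  exact hw P _ (hs₂.of_reg_eq (fun _ _ => rfl) rfl) h

/-! ### Time bounds -/

/-- A command without loops. -/
def LoopFree : Cmd → Prop
  | skip => True
  | assign _ _ => True
  | store _ _ => True
  | seq c d => c.LoopFree ∧ d.LoopFree
  | ite _ c d => c.LoopFree ∧ d.LoopFree
  | loop _ _ => False

/-- The effect of a command without loops; loops are ignored. -/
def exec : Cmd → Store → Store
  | skip, σ => σ
  | assign v e, σ => σ.set v (e.eval σ)
  | store e f, σ => σ.write (e.eval σ) (f.eval σ)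
  | seq c d, σ => d.exec (c.exec σ)
  | ite e c d, σ => if e.eval σ = 0 then d.exec σ else c.exec σ
  | loop _ _, σ => σ

/-- A command without loops executes every instruction at most once. -/
theorem LoopFree.exists_runs {c : Cmd} (hc : c.LoopFree) (σ : Store) :
    ∃ t ≤ c.size, c.Runs σ (c.exec σ) t := by
  induction c generalizing σ with
  | skip => exact ⟨_, le_rfl, runs_skip σ⟩
  | assign v e => exact ⟨_, le_rfl, runs_assign v e σ⟩
  | store e f => exact ⟨_, le_rfl, runs_store e f σ⟩
  | seq c d ihc ihd =>
    obtain ⟨t, ht, h⟩ := ihc hc.1 σ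
    obtain ⟨t', ht', h'⟩ := ihd hc.2 (c.exec σ)
    exact ⟨_, Nat.add_le_add ht ht', h.seq h'⟩
  | ite e c d ihc ihd =>
    by_cases he : e.eval σ = 0
    · obtain ⟨t, ht, h⟩ := ihd hc.2 σ
      refine ⟨_, ?_, by rw [exec, if_pos he]; exact h.ite_of_eq he⟩
      simp only [size]
      omega
    · obtain ⟨t, ht, h⟩ := ihc hc.1 σ
      refine ⟨_, ?_, by rw [exec, if_neg he]; exact h.ite_of_ne he⟩
      simp only [size]
      omega
  | loop e c _ => exact hc.elim

/-- Total correctness of a command for the precondition `A` and the postcondition `B`, with the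
bound `T` on the running time. -/
def Triple (A : Store → Prop) (c : Cmd) (B : Store → Prop) (T : ℕ) : Prop :=
  ∀ σ, A σ → ∃ σ', B σ' ∧ ∃ t ≤ T, c.Runs σ σ' t

theorem LoopFree.triple {A B : Store → Prop} {c : Cmd} (hc : c.LoopFree)
    (h : ∀ σ, A σ → B (c.exec σ)) : Triple A c B c.size :=
  fun σ hσ => ⟨c.exec σ, h σ hσ, hc.exists_runs σ⟩

theorem Triple.seq {A B C : Store → Prop} {c d : Cmd} {T T' : ℕ} (hc : Triple A c B T)
    (hd : Triple B d C T') : Triple A (seq c d) C (T + T') := by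
  intro σ hσ
  obtain ⟨σ', hσ', t, ht, h⟩ := hc σ hσ
  obtain ⟨σ'', hσ'', t', ht', h'⟩ := hd σ' hσ'
  exact ⟨σ'', hσ'', _, Nat.add_le_add ht ht', h.seq h'⟩

theorem Triple.mono {A A' B B' : Store → Prop} {c : Cmd} {T T' : ℕ} (h : Triple A c B T)
    (hA : ∀ σ, A' σ → A σ) (hB : ∀ σ, B σ → B' σ) (hT : T ≤ T') : Triple A' c B' T' := by
  intro σ hσ
  obtain ⟨σ', hσ', t, ht, hr⟩ := h σ (hA σ hσ)
  exact ⟨σ', hB _ hσ', t, ht.trans hT, hr⟩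

/-- If the running time of each command is at most `m` times its size, so is that of the
sequence. -/
theorem Triple.seq_mul {A B C : Store → Prop} {c d : Cmd} {m : ℕ}
    (hc : Triple A c B (m * c.size)) (hd : Triple B d C (m * d.size)) :
    Triple A (.seq c d) C (m * (Cmd.seq c d).size) :=
  (hc.seq hd).mono (fun _ h => h) (fun _ h => h) (by rw [size, Nat.mul_add])

theorem LoopFree.triple_mul {A B : Store → Prop} {c : Cmd} {m : ℕ} (hm : 0 < m)
    (hc : c.LoopFree) (h : ∀ σ, A σ → B (c.exec σ)) : Triple A c B (m * c.size) :=
  (hc.triple h).mono (fun _ h => h) (fun _ h => h) (Nat.le_mul_of_pos_left _ hm)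

/-- A loop whose invariant `I k` carries a bound `k` on the number of iterations left. -/
theorem LoopFree.triple_loop {I : ℕ → Store → Prop} {e : Expr} {c : Cmd} (hc : c.LoopFree)
    (h : ∀ k σ, I k σ → e.eval σ ≠ 0 → ∃ k' < k, I k' (c.exec σ)) (k : ℕ) :
    Triple (I k) (Cmd.loop e c) (fun σ => (∃ k, I k σ) ∧ e.eval σ = 0)
      ((k + 1) * (Cmd.loop e c).size) := by
  intro σ hσ
  induction k using Nat.strong_induction_on generalizing σ with
  | _ k ih =>
    by_cases he : e.eval σ = 0
    · refine ⟨σ, ⟨⟨k, hσ⟩, he⟩, _, ?_, Runs.loop_of_eq he⟩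
      refine le_trans ?_ (Nat.le_mul_of_pos_left _ (Nat.succ_pos k))
      simp only [size]
      omega
    · obtain ⟨k', hk', hI⟩ := h k σ hσ he
      obtain ⟨σ', hσ', t', ht', hw⟩ := ih k' hk' _ hI
      obtain ⟨t, ht, hr⟩ := hc.exists_runs σ
      refine ⟨σ', hσ', _, ?_, Runs.loop_of_ne he hr hw⟩
      have h₁ : (k' + 1) * (Cmd.loop e c).size ≤ k * (Cmd.loop e c).size :=
        Nat.mul_le_mul_right _ hk'
      rw [Nat.succ_mul]
      simp only [size] at *
      omega

end Cmd

theorem iterate_step_of_halted {P : Program} {s : State} (h : Halted P s) (t : ℕ) :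
    (step P)^[t] s = s := by
  refine Function.iterate_fixed ?_ t
  rw [step, List.getElem?_eq_none h]

/-- A command that computes the truth value of `Q` in the variable `n` gives a decision
procedure. -/
theorem decidesWithin_of_triple {Q : ∀ n : ℕ, SimpleGraph (Fin n) → Prop} {T : ℕ → ℕ} {c : Cmd}
    (h : ∀ (n : ℕ) (G : SimpleGraph (Fin n)),
      Cmd.Triple (fun σ => Represents σ (input G)) c
        (fun σ => Q n G ∧ σ.var .n = 1 ∨ ¬ Q n G ∧ σ.var .n = 0) (T n)) :
    DecidesWithin (c.compile 0) Q T := by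
  intro n G
  have hs : Represents ⟨fun v => (input G).reg v.reg, (input G).mem⟩ (input G) :=
    ⟨fun _ => rfl, rfl⟩
  obtain ⟨σ', hσ', t, ht, hr⟩ := h n G _ hs
  obtain ⟨hpc, hs'⟩ := hr (c.compile 0) (input G) hs (List.prefix_refl _)
  have hhalt : Halted (c.compile 0) ((step (c.compile 0))^[t] (input G)) := by
    rw [Halted, hpc, Cmd.length_compile]
    exact Nat.le_add_left _ _
  have heq : (step (c.compile 0))^[T n] (input G) = (step (c.compile 0))^[t] (input G) := by
    rw [← iterate_step_of_halted hhalt (T n - t), ← Function.iterate_add_apply,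
      Nat.sub_add_cancel ht]
  rw [heq]
  refine ⟨hhalt, ?_⟩
  have hreg := hs'.reg .n
  rw [Var.reg] at hreg
  rw [hreg]
  rcases hσ' with ⟨hQ, h⟩ | ⟨hQ, h⟩
  · rw [h, if_pos hQ]
  · rw [h, if_neg hQ]

/-! ### Tables in the memory -/

/-- The tables that the program keeps in the memory. In the description of their entries, `i` is a
vertex, sets of pairs of vertices are encoded by `bitSet`, and a pair is identified with the number
`2 ^ k` that encodes its singleton. -/
inductive Table where
  /-- entry `i`: the pairs with first component `i` -/
  | row
  /-- entry `i`: the pairs with second component `i` -/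
  | col
  /-- entry `i`: the pairs whose first component is adjacent to `i` -/
  | nbrRow
  /-- entry `i`: the pairs whose second component is adjacent to `i` -/
  | nbrCol
  /-- entry `2 ^ k`: the first component of that pair -/
  | fst
  /-- entry `2 ^ k`: the second component of that pair -/
  | snd
  deriving DecidableEq

/-- The residue modulo `8` of the addresses of the entries of a table, counted from the end of the
input. -/
def Table.offset : Table → ℕ
  | row => 0 | col => 1 | nbrRow => 2 | nbrCol => 3 | fst => 4 | snd => 5

theorem Table.offset_lt (k : Table) : k.offset < 8 := by
  cases k <;> decide

theorem Table.offset_injective : Function.Injective Table.offset := by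
  intro k k' h
  cases k <;> cases k' <;> first | rfl | exact absurd h (by decide)

namespace Store

/-- Entry `i` of the table `k`. -/
def cell (σ : Store) (k : Table) (i : ℕ) : ℕ :=
  σ.mem (σ.var .size + (8 * i + k.offset))

/-- Put `x` into entry `i` of the table `k`. -/
def writeCell (σ : Store) (k : Table) (i x : ℕ) : Store :=
  σ.write (σ.var .size + (8 * i + k.offset)) x

@[simp] theorem var_writeCell (σ : Store) (k : Table) (i x : ℕ) :
    (σ.writeCell k i x).var = σ.var := rfl

@[simp] theorem cell_set (σ : Store) (k : Table) (i x : ℕ) {v : Var} (hv : v ≠ .size) :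
    (σ.set v x).cell k i = σ.cell k i := by
  simp [cell, hv.symm]

@[simp] theorem cell_writeCell (σ : Store) (k k' : Table) (i j x : ℕ) :
    (σ.writeCell k i x).cell k' j = if k' = k ∧ j = i then x else σ.cell k' j := by
  have h : σ.var .size + (8 * j + k'.offset) = σ.var .size + (8 * i + k.offset) ↔
      k' = k ∧ j = i := by
    constructor
    · intro h
      have := k.offset_lt
      have := k'.offset_lt
      exact ⟨Table.offset_injective (by omega), by omega⟩
    · rintro ⟨rfl, rfl⟩
      rfl
  simp only [cell, writeCell, var_write, mem_write, h]

theorem mem_writeCell_of_lt (σ : Store) (k : Table) (i x : ℕ) {y : ℕ} (hy : y < σ.var .size) :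
    (σ.writeCell k i x).mem y = σ.mem y := by
  rw [writeCell, mem_write, if_neg (by omega)]

theorem cell_congr {σ τ : Store} (hm : τ.mem = σ.mem) (hs : τ.var .size = σ.var .size)
    (k : Table) (i : ℕ) : τ.cell k i = σ.cell k i := by
  rw [cell, cell, hm, hs]

end Store

/-- The address of an entry of a table. -/
def Expr.address (k : Table) (e : Expr) : Expr :=
  .add (.var .size) (.add (.double (.double (.double e))) (.lit k.offset))

theorem Expr.eval_address (σ : Store) (k : Table) (e : Expr) :
    (Expr.address k e).eval σ = σ.var .size + (8 * e.eval σ + k.offset) := by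
  simp only [address, eval]
  omega

/-- The entry of the table `k` whose index is the value of `e`. -/
def Expr.cell (k : Table) (e : Expr) : Expr := .mem (.address k e)

@[simp] theorem Expr.eval_cell (σ : Store) (k : Table) (e : Expr) :
    (Expr.cell k e).eval σ = σ.cell k (e.eval σ) := by
  rw [cell, eval, eval_address, Store.cell]

/-- The lowest binary digit `1` of a number, as a power of two. -/
def Expr.lowest (e : Expr) : Expr := .sub e (.band e (.sub e (.lit 1)))

namespace Cmd

/-- Put the value of `f` into the entry of the table `k` whose index is the value of `e`. -/
def storeCell (k : Table) (e f : Expr) : Cmd := store (.address k e) f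

@[simp] theorem exec_storeCell (σ : Store) (k : Table) (e f : Expr) :
    (storeCell k e f).exec σ = σ.writeCell k (e.eval σ) (f.eval σ) := by
  rw [storeCell, exec, Expr.eval_address, Store.writeCell]

theorem exec_ite_ind {A : Store → Prop} {e : Expr} {c d : Cmd} {σ : Store} (hc : A (c.exec σ))
    (hd : A (d.exec σ)) : A ((ite e c d).exec σ) := by
  by_cases he : e.eval σ = 0
  · rwa [exec, if_pos he]
  · rwa [exec, if_neg he]

/-- `v := v + e` -/
def increase (v : Var) (e : Expr) : Cmd := assign v (.add (.var v) e)

/-- `v := v - e` -/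
def decrease (v : Var) (e : Expr) : Cmd := assign v (.sub (.var v) e)

/-- Sequential composition of a list of commands. -/
def block : List Cmd → Cmd
  | [] => skip
  | c :: l => seq c (block l)

end Cmd

/-! ### The decision procedure -/

open RAM.Expr RAM.Cmd

/-- `size := n * n` -/
def computeSize : Cmd :=
  .loop (.sub (var .n) (var .a)) (block [increase .size (var .n), increase .a (lit 1)])

/-- Proceed from one pair `(a, b)` of vertices to the next; `p` is its index `a * n + b`. -/
def advance : Cmd :=
  block [increase .p (lit 1), increase .b (lit 1),
    ite (.sub (var .n) (var .b)) skip (block [assign .b (lit 0), increase .a (lit 1)])]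

/-- Enter the pair `(a, b)`, which is encoded by `x`, into the tables, and into the set `rest` if
it is an arc; then double `x`. -/
def enterPair : Cmd :=
  block [
    ite (mem (var .p)) (increase .rest (var .x)) skip,
    storeCell .row (var .a) (.add (.cell .row (var .a)) (var .x)),
    storeCell .col (var .b) (.add (.cell .col (var .b)) (var .x)),
    storeCell .fst (var .x) (var .a),
    storeCell .snd (var .x) (var .b),
    increase .x (var .x)]

/-- Enter the row and the column of `b` into the tables for the neighbours of `a`, if `(a, b)` is
an arc. -/
def enterNeighbour : Cmd :=
  ite (mem (var .p))
    (block [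
      storeCell .nbrRow (var .a) (.add (.cell .nbrRow (var .a)) (.cell .row (var .b))),
      storeCell .nbrCol (var .a) (.add (.cell .nbrCol (var .a)) (.cell .col (var .b)))])
    skip

/-- If `front` is empty, move an arc from `rest` to `front`, and let `rev` be the opposite arc. -/
def enterClass : Cmd :=
  ite (var .front) skip
    (block [
      assign .front (lowest (var .rest)),
      decrease .rest (var .front),
      assign .rev (.band (.cell .row (.cell .snd (var .front)))
        (.cell .col (.cell .fst (var .front))))])

/-- Take an arc `x = (a, b)` out of `front`, and compare it with `rev`. -/
def popArc : Cmd :=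
  block [
    assign .x (lowest (var .front)),
    decrease .front (var .x),
    increase .bad (.band (var .x) (var .rev)),
    assign .a (.cell .fst (var .x)),
    assign .b (.cell .snd (var .x))]

/-- Move from `rest` to `front` the arcs that are in entry `v` of the table `k`, but not in
entry `w` of the table `k'`. -/
def absorb (k k' : Table) (v w : Var) : Cmd :=
  block [
    assign .new (.band (var .rest) (.cell k (var v))),
    decrease .new (.band (var .new) (.cell k' (var w))),
    decrease .rest (var .new),
    increase .front (var .new)]

/-- One round of the exploration of the implication classes. -/
def explore : Cmd :=
  block [enterClass, popArc, absorb .row .nbrCol .a .b, absorb .col .nbrRow .b .a]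

/-- The program that decides whether a graph has a transitive orientation. -/
def decideOrientation : Cmd :=
  block [
    computeSize,
    block [assign .a (lit 0), assign .x (lit 1)],
    .loop (.sub (var .size) (var .p)) (seq enterPair advance),
    block [assign .p (lit 0), assign .a (lit 0), assign .b (lit 0)],
    .loop (.sub (var .size) (var .p)) (seq enterNeighbour advance),
    .loop (.add (var .rest) (var .front)) explore,
    assign .n (.sub (lit 1) (var .bad))]

/-! ### Correctness of the decision procedure -/

variable {n : ℕ}

/-- The index of a pair of vertices in the adjacency matrix. -/
def pos (z : Fin n × Fin n) : ℕ := z.1 * n + z.2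

theorem pos_div (z : Fin n × Fin n) : pos z / n = z.1 := by
  have h := z.2.isLt
  rw [pos, mul_comm, Nat.mul_add_div (by omega), Nat.div_eq_of_lt h, add_zero]

theorem pos_mod (z : Fin n × Fin n) : pos z % n = z.2 := by
  rw [pos, mul_comm, Nat.mul_add_mod, Nat.mod_eq_of_lt z.2.isLt]

theorem pos_injective : Function.Injective (pos (n := n)) := by
  intro z w h
  refine Prod.ext (Fin.ext ?_) (Fin.ext ?_)
  · rw [← pos_div z, ← pos_div w, h]
  · rw [← pos_mod z, ← pos_mod w, h]

theorem pos_lt (z : Fin n × Fin n) : pos z < n * n := by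
  have h₁ := z.1.isLt
  have h₂ := z.2.isLt
  have : ((z.1 : ℕ) + 1) * n ≤ n * n := Nat.mul_le_mul_right _ h₁
  rw [Nat.succ_mul] at this
  rw [pos]
  omega

theorem exists_pos_eq {p : ℕ} (hp : p < n * n) : ∃ z : Fin n × Fin n, pos z = p := by
  have hn : 0 < n := Nat.pos_of_ne_zero (by rintro rfl; simp at hp)
  exact ⟨⟨⟨p / n, Nat.div_lt_of_lt_mul hp⟩, ⟨p % n, Nat.mod_lt _ hn⟩⟩, Nat.div_add_mod' p n⟩

theorem bitSet_filter_pos_lt_succ (Q : Fin n × Fin n → Prop) [DecidablePred Q]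
    (z : Fin n × Fin n) :
    bitSet pos {w | Q w ∧ pos w < pos z + 1} =
      bitSet pos {w | Q w ∧ pos w < pos z} + if Q z then 2 ^ pos z else 0 := by
  by_cases hQ : Q z
  · rw [if_pos hQ, ← bitSet_singleton (pos := pos) z, ← bitSet_union (by simp)]
    congr 1
    ext w
    simp only [Finset.mem_filter, Finset.mem_univ, true_and, Finset.mem_union,
      Finset.mem_singleton]
    constructor
    · rintro ⟨h₁, h₂⟩
      rcases Nat.lt_succ_iff_lt_or_eq.1 h₂ with h | h
      · exact Or.inl ⟨h₁, h⟩
      · exact Or.inr (pos_injective h)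
    · rintro (⟨h₁, h₂⟩ | rfl)
      · exact ⟨h₁, by omega⟩
      · exact ⟨hQ, by omega⟩
  · rw [if_neg hQ, add_zero]
    congr 1
    ext w
    simp only [Finset.mem_filter, Finset.mem_univ, true_and]
    refine and_congr_right fun hw => ⟨fun h => ?_, fun h => by omega⟩
    refine lt_of_le_of_ne (Nat.lt_succ_iff.1 h) fun h => hQ ?_
    rwa [← pos_injective h]

open Classical in
theorem mem_input (G : SimpleGraph (Fin n)) (z : Fin n × Fin n) :
    (input G).mem (pos z) = if G.Adj z.1 z.2 then 1 else 0 := by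
  simp only [input]
  refine if_congr ⟨?_, fun h => ⟨z.1, z.2, rfl, h⟩⟩ rfl rfl
  rintro ⟨i, j, h, hij⟩
  obtain rfl : z = (i, j) := pos_injective h
  exact hij

/-- Behind the adjacency matrix the memory is empty, so all table entries are zero at the start. -/
theorem mem_input_of_le (G : SimpleGraph (Fin n)) {y : ℕ} (hy : n * n ≤ y) :
    (input G).mem y = 0 := by
  simp only [input]
  refine if_neg ?_
  rintro ⟨i, j, rfl, -⟩
  exact absurd (pos_lt (i, j)) (not_lt.2 hy)

/-- The loop over all pairs of vertices has reached the pair with index `p`. -/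
structure AtPair (n p : ℕ) (σ : Store) : Prop where
  n_eq : σ.var .n = n
  size_eq : σ.var .size = n * n
  p_eq : σ.var .p = p
  a_eq : σ.var .a = p / n
  b_eq : σ.var .b = p % n

theorem mem_advance (σ : Store) : (advance.exec σ).mem = σ.mem := by
  change ((ite _ _ _).exec _).mem = _
  exact exec_ite_ind (A := fun τ => τ.mem = σ.mem) rfl rfl

theorem var_advance (σ : Store) (v : Var) (hp : v ≠ .p) (ha : v ≠ .a) (hb : v ≠ .b) :
    (advance.exec σ).var v = σ.var v := by
  change ((ite _ _ _).exec _).var v = _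
  refine exec_ite_ind (A := fun τ => τ.var v = σ.var v) ?_ ?_ <;>
    simp [block, exec, increase, hp, ha, hb]

theorem AtPair.advance {p : ℕ} {σ : Store} (h : AtPair n p σ) (hp : p < n * n) :
    AtPair n (p + 1) (advance.exec σ) := by
  have hn : 0 < n := Nat.pos_of_ne_zero (by rintro rfl; simp at hp)
  have hb : p % n < n := Nat.mod_lt _ hn
  have hdm := Nat.div_add_mod p n
  by_cases hlast : p % n + 1 = n
  · have h₁ : (p + 1) / n = p / n + 1 := by
      rw [show p + 1 = n * (p / n + 1) by rw [Nat.mul_succ]; omega]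
      exact Nat.mul_div_cancel_left _ hn
    have h₂ : (p + 1) % n = 0 := by
      rw [show p + 1 = n * (p / n + 1) by rw [Nat.mul_succ]; omega]
      exact Nat.mul_mod_right _ _
    constructor <;>
      simp [RAM.advance, block, exec, increase, eval, h.n_eq, h.size_eq, h.p_eq, h.a_eq, h.b_eq,
        hlast, h₁, h₂]
  · have hlt : p % n + 1 < n := by omega
    have h₁ : (p + 1) / n = p / n := by
      rw [show p + 1 = n * (p / n) + (p % n + 1) by omega, Nat.mul_add_div hn,
        Nat.div_eq_of_lt hlt, add_zero]
    have h₂ : (p + 1) % n = p % n + 1 := by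
      rw [show p + 1 = n * (p / n) + (p % n + 1) by omega, Nat.mul_add_mod,
        Nat.mod_eq_of_lt hlt]
    have h₃ : n - (p % n + 1) ≠ 0 := by omega
    constructor <;>
      simp [RAM.advance, block, exec, increase, eval, h.n_eq, h.size_eq, h.p_eq, h.a_eq, h.b_eq,
        h₁, h₂, h₃]

open Classical in
/-- The pairs with index less than `p` have been entered into the tables. -/
structure Entered (G : SimpleGraph (Fin n)) (p : ℕ) (σ : Store) : Prop where
  input_eq : ∀ z : Fin n × Fin n, σ.mem (pos z) = if G.Adj z.1 z.2 then 1 else 0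
  x_eq : σ.var .x = 2 ^ p
  rest_eq : σ.var .rest = bitSet (pos (n := n)) {z | G.Adj z.1 z.2 ∧ pos z < p}
  front_eq : σ.var .front = 0
  bad_eq : σ.var .bad = 0
  row_eq : ∀ i : Fin n, σ.cell .row i = bitSet (pos (n := n)) {z | z.1 = i ∧ pos z < p}
  col_eq : ∀ i : Fin n, σ.cell .col i = bitSet (pos (n := n)) {z | z.2 = i ∧ pos z < p}
  nbrRow_eq : ∀ i : Fin n, σ.cell .nbrRow i = 0
  nbrCol_eq : ∀ i : Fin n, σ.cell .nbrCol i = 0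
  fst_eq : ∀ z : Fin n × Fin n, pos z < p → σ.cell .fst (2 ^ pos z) = z.1
  snd_eq : ∀ z : Fin n × Fin n, pos z < p → σ.cell .snd (2 ^ pos z) = z.2

theorem Entered.advance {G : SimpleGraph (Fin n)} {p : ℕ} {σ : Store} (h : Entered G p σ) :
    Entered G p (advance.exec σ) := by
  have hm := mem_advance σ
  have hv := var_advance σ
  have hc := Store.cell_congr hm (hv .size (by decide) (by decide) (by decide))
  obtain ⟨h₁, h₂, h₃, h₄, h₅, h₆, h₇, h₈, h₉, h₁₀, h₁₁⟩ := h
  constructor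
  · simpa only [hm] using h₁
  · rwa [hv _ (by decide) (by decide) (by decide)]
  · rwa [hv _ (by decide) (by decide) (by decide)]
  · rwa [hv _ (by decide) (by decide) (by decide)]
  · rwa [hv _ (by decide) (by decide) (by decide)]
  all_goals simpa only [hc]

theorem Entered.enterPair {G : SimpleGraph (Fin n)} {z : Fin n × Fin n} {σ : Store}
    (h : Entered G (pos z) σ) (hσ : AtPair n (pos z) σ) :
    Entered G (pos z + 1) (enterPair.exec σ) ∧ AtPair n (pos z) (enterPair.exec σ) := by
  classical
  have ha : σ.var .a = z.1 := hσ.a_eq.trans (pos_div z)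
  have hb : σ.var .b = z.2 := hσ.b_eq.trans (pos_mod z)
  have hx := h.x_eq
  have hlt : σ.var .p < σ.var .size := by
    rw [hσ.p_eq, hσ.size_eq]
    exact pos_lt z
  obtain ⟨τ, hτ⟩ : ∃ τ, τ = σ.set .rest (σ.var .rest + if G.Adj z.1 z.2 then 2 ^ pos z else 0) :=
    ⟨_, rfl⟩
  have hrest : (ite (mem (var .p)) (increase .rest (var .x)) skip).exec σ = τ := by
    by_cases hz : G.Adj z.1 z.2
    · simp [exec, eval, hσ.p_eq, h.input_eq, increase, hx, hz, hτ]
    · simp [exec, eval, hσ.p_eq, h.input_eq, hz, hτ, Store.set]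
  have hexec : RAM.enterPair.exec σ =
      ((((τ.writeCell .row z.1 (σ.cell .row z.1 + 2 ^ pos z)).writeCell .col z.2
        (σ.cell .col z.2 + 2 ^ pos z)).writeCell .fst (2 ^ pos z) z.1).writeCell .snd
        (2 ^ pos z) z.2).set .x (2 ^ (pos z + 1)) := by
    rw [RAM.enterPair, block, exec, hrest]
    simp [block, exec, eval, increase, hτ, ha, hb, hx, pow_succ, mul_two]
  rw [hexec]
  -- entries of the tables lie behind the input, so the adjacency matrix is still intact
  refine ⟨⟨fun w => ?_, by simp, ?_, by simp [hτ, h.front_eq], by simp [hτ, h.bad_eq], fun i => ?_,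
    fun i => ?_, fun i => by simp [hτ, h.nbrRow_eq], fun i => by simp [hτ, h.nbrCol_eq],
    fun w hw => ?_, fun w hw => ?_⟩, ?_⟩
  · have hw : pos w < τ.var .size := by
      simpa [hτ, hσ.size_eq] using pos_lt w
    rw [Store.mem_set]
    repeat rw [Store.mem_writeCell_of_lt _ _ _ _ (by simpa using hw)]
    simp [hτ, h.input_eq]
  · rw [bitSet_filter_pos_lt_succ (fun w => G.Adj w.1 w.2), ← h.rest_eq]
    simp [hτ]
  · rw [bitSet_filter_pos_lt_succ (fun w => w.1 = i), ← h.row_eq]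
    by_cases hi : z.1 = i
    · simp [hi]
    · have : (i : ℕ) ≠ z.1 := fun h => hi (Fin.ext h.symm)
      simp [hτ, hi, this]
  · rw [bitSet_filter_pos_lt_succ (fun w => w.2 = i), ← h.col_eq]
    by_cases hi : z.2 = i
    · simp [hi]
    · have : (i : ℕ) ≠ z.2 := fun h => hi (Fin.ext h.symm)
      simp [hτ, hi, this]
  · rcases Nat.lt_succ_iff_lt_or_eq.1 hw with hw | hw
    · simp [hτ, h.fst_eq w hw, hw.ne]
    · simp [pos_injective hw]
  · rcases Nat.lt_succ_iff_lt_or_eq.1 hw with hw | hw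
    · simp [hτ, h.snd_eq w hw, hw.ne]
    · simp [pos_injective hw]
  · obtain ⟨h₁, h₂, h₃, h₄, h₅⟩ := hσ
    constructor <;> simpa [hτ]

open Classical in
/-- The tables that describe the pairs of vertices are complete. -/
structure Tables (n : ℕ) (σ : Store) : Prop where
  row_eq : ∀ i : Fin n, σ.cell .row i = bitSet (pos (n := n)) {z | z.1 = i}
  col_eq : ∀ i : Fin n, σ.cell .col i = bitSet (pos (n := n)) {z | z.2 = i}
  fst_eq : ∀ z : Fin n × Fin n, σ.cell .fst (2 ^ pos z) = z.1
  snd_eq : ∀ z : Fin n × Fin n, σ.cell .snd (2 ^ pos z) = z.2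

open Classical in
/-- The pairs with index less than `p` have been used to fill the tables of neighbours. -/
structure NeighboursEntered (G : SimpleGraph (Fin n)) (p : ℕ) (σ : Store) : Prop where
  tables : Tables n σ
  input_eq : ∀ z : Fin n × Fin n, σ.mem (pos z) = if G.Adj z.1 z.2 then 1 else 0
  rest_eq : σ.var .rest = bitSet (pos (n := n)) {z | G.Adj z.1 z.2}
  front_eq : σ.var .front = 0
  bad_eq : σ.var .bad = 0
  nbrRow_eq : ∀ i : Fin n,
    σ.cell .nbrRow i = bitSet (pos (n := n)) {z | G.Adj i z.1 ∧ pos (i, z.1) < p}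
  nbrCol_eq : ∀ i : Fin n,
    σ.cell .nbrCol i = bitSet (pos (n := n)) {z | G.Adj i z.2 ∧ pos (i, z.2) < p}

theorem Tables.of_cell_eq {σ τ : Store} (h : Tables n σ)
    (hc : ∀ k i, k ≠ .nbrRow → k ≠ .nbrCol → τ.cell k i = σ.cell k i) : Tables n τ := by
  obtain ⟨h₁, h₂, h₃, h₄⟩ := h
  constructor
  · intro i
    rw [hc _ _ (by decide) (by decide), h₁]
  · intro i
    rw [hc _ _ (by decide) (by decide), h₂]
  · intro i
    rw [hc _ _ (by decide) (by decide), h₃]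
  · intro i
    rw [hc _ _ (by decide) (by decide), h₄]

theorem NeighboursEntered.advance {G : SimpleGraph (Fin n)} {p : ℕ} {σ : Store}
    (h : NeighboursEntered G p σ) : NeighboursEntered G p (advance.exec σ) := by
  have hm := mem_advance σ
  have hv := var_advance σ
  have hc := Store.cell_congr hm (hv .size (by decide) (by decide) (by decide))
  obtain ⟨h₁, h₂, h₃, h₄, h₅, h₆, h₇⟩ := h
  refine ⟨h₁.of_cell_eq fun k i _ _ => hc k i, ?_, ?_, ?_, ?_, ?_, ?_⟩
  · simpa only [hm] using h₂
  · rwa [hv _ (by decide) (by decide) (by decide)]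
  · rwa [hv _ (by decide) (by decide) (by decide)]
  · rwa [hv _ (by decide) (by decide) (by decide)]
  all_goals simpa only [hc]

/-- The sets in the tables of neighbours grow by a row or a column when an arc is entered. Here
`c` is one of the two components of a pair. -/
theorem bitSet_neighbours_succ (G : SimpleGraph (Fin n)) (c : Fin n × Fin n → Fin n)
    (z : Fin n × Fin n) (i : Fin n) [DecidableRel G.Adj] :
    bitSet (pos (n := n)) {w | G.Adj i (c w) ∧ pos (i, c w) < pos z + 1} =
      bitSet (pos (n := n)) {w | G.Adj i (c w) ∧ pos (i, c w) < pos z} +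
        if i = z.1 ∧ G.Adj z.1 z.2 then bitSet (pos (n := n)) {w | c w = z.2} else 0 := by
  have hlt : ∀ w : Fin n × Fin n, pos (i, c w) < pos z + 1 ↔
      pos (i, c w) < pos z ∨ i = z.1 ∧ c w = z.2 := by
    intro w
    rw [Nat.lt_succ_iff_lt_or_eq, pos_injective.eq_iff, Prod.ext_iff]
  split_ifs with h
  · obtain ⟨rfl, hz⟩ := h
    rw [← bitSet_union]
    · congr 1
      ext w
      simp only [Finset.mem_filter, Finset.mem_univ, true_and, Finset.mem_union, hlt]
      constructor
      · rintro ⟨h₁, h₂ | h₂⟩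
        · exact Or.inl ⟨h₁, h₂⟩
        · exact Or.inr h₂
      · rintro (h | h)
        · exact ⟨h.1, Or.inl h.2⟩
        · exact ⟨by rwa [h], Or.inr h⟩
    · rw [Finset.disjoint_left]
      intro w hw hw'
      simp only [Finset.mem_filter, Finset.mem_univ, true_and] at hw hw'
      rw [hw'] at hw
      exact lt_irrefl _ hw.2
  · rw [add_zero]
    congr 1
    ext w
    simp only [Finset.mem_filter, Finset.mem_univ, true_and, hlt]
    refine and_congr_right fun hw => or_iff_left ?_
    rintro ⟨rfl, h'⟩
    exact h ⟨rfl, h' ▸ hw⟩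

theorem NeighboursEntered.enterNeighbour {G : SimpleGraph (Fin n)} {z : Fin n × Fin n} {σ : Store}
    (h : NeighboursEntered G (pos z) σ) (hσ : AtPair n (pos z) σ) :
    NeighboursEntered G (pos z + 1) (enterNeighbour.exec σ) ∧
      AtPair n (pos z) (enterNeighbour.exec σ) := by
  classical
  have ha : σ.var .a = z.1 := hσ.a_eq.trans (pos_div z)
  have hb : σ.var .b = z.2 := hσ.b_eq.trans (pos_mod z)
  by_cases hz : G.Adj z.1 z.2
  · have hexec : RAM.enterNeighbour.exec σ =
        (σ.writeCell .nbrRow z.1 (σ.cell .nbrRow z.1 + σ.cell .row z.2)).writeCell .nbrCol z.1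
          (σ.cell .nbrCol z.1 + σ.cell .col z.2) := by
      simp [RAM.enterNeighbour, block, exec, eval, hσ.p_eq, h.input_eq, hz, ha, hb]
    rw [hexec]
    refine ⟨⟨h.tables.of_cell_eq fun k i h₁ h₂ => by simp [h₁, h₂], fun w => ?_, h.rest_eq,
      h.front_eq, h.bad_eq, fun i => ?_, fun i => ?_⟩,
      ⟨hσ.n_eq, hσ.size_eq, hσ.p_eq, hσ.a_eq, hσ.b_eq⟩⟩
    · have hw : pos w < σ.var .size := by
        simpa [hσ.size_eq] using pos_lt w
      repeat rw [Store.mem_writeCell_of_lt _ _ _ _ (by simpa using hw)]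
      exact h.input_eq w
    · rw [bitSet_neighbours_succ, ← h.nbrRow_eq, ← h.tables.row_eq]
      by_cases hi : i = z.1
      · simp [hi, hz]
      · have : (i : ℕ) ≠ z.1 := fun h => hi (Fin.ext h)
        simp [hi, this]
    · rw [bitSet_neighbours_succ, ← h.nbrCol_eq, ← h.tables.col_eq]
      by_cases hi : i = z.1
      · simp [hi, hz]
      · have : (i : ℕ) ≠ z.1 := fun h => hi (Fin.ext h)
        simp [hi, this]
  · have hexec : RAM.enterNeighbour.exec σ = σ := by
      simp [RAM.enterNeighbour, exec, eval, hσ.p_eq, h.input_eq, hz]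
    rw [hexec]
    refine ⟨⟨h.tables, h.input_eq, h.rest_eq, h.front_eq, h.bad_eq, fun i => ?_, fun i => ?_⟩, hσ⟩
    · rw [bitSet_neighbours_succ, if_neg fun h => hz h.2, add_zero, h.nbrRow_eq]
    · rw [bitSet_neighbours_succ, if_neg fun h => hz h.2, add_zero, h.nbrCol_eq]

open Classical in
/-- All tables are complete. -/
structure AllTables (G : SimpleGraph (Fin n)) (σ : Store) : Prop where
  tables : Tables n σ
  nbrRow_eq : ∀ i : Fin n, σ.cell .nbrRow i = bitSet (pos (n := n)) {z | G.Adj i z.1}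
  nbrCol_eq : ∀ i : Fin n, σ.cell .nbrCol i = bitSet (pos (n := n)) {z | G.Adj i z.2}

open Classical in
/-- The arcs of the graph: each edge in both directions. -/
noncomputable def arcs (G : SimpleGraph (Fin n)) : Finset (Fin n × Fin n) :=
  {z | G.Adj z.1 z.2}

theorem mem_arcs {G : SimpleGraph (Fin n)} {z : Fin n × Fin n} :
    z ∈ arcs G ↔ G.Adj z.1 z.2 := by
  simp [arcs]

/-- The memory holds all tables, and the sets `rest` and `front` are `R` and `W`. -/
structure Holds (G : SimpleGraph (Fin n)) (R W : Finset (Fin n × Fin n)) (σ : Store) : Prop where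
  tables : AllTables G σ
  rest_eq : σ.var .rest = bitSet pos R
  front_eq : σ.var .front = bitSet pos W

/-- The exploration is within the class of `e`. -/
def InClass (G : SimpleGraph (Fin n)) (R₀ R W : Finset (Fin n × Fin n)) (e : Fin n × Fin n)
    (σ : Store) : Prop :=
  Holds G R W σ ∧ σ.var .rev = 2 ^ pos e.swap ∧
    Exploring G.Forces Prod.swap (arcs G) R₀ R W e (σ.var .bad = 0)

/-- The invariant of the main loop, with `k` arcs left to expand. -/
def LoopInvariant (G : SimpleGraph (Fin n)) (k : ℕ) (σ : Store) : Prop :=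
  ∃ R W, R.card + W.card = k ∧
    ((W = ∅ ∧ Holds G R W σ ∧ Explored G.Forces Prod.swap (arcs G) R (σ.var .bad = 0)) ∨
      ∃ R₀ e, InClass G R₀ R W e σ)

theorem AllTables.of_cell_eq {G : SimpleGraph (Fin n)} {σ τ : Store} (h : AllTables G σ)
    (hc : ∀ k i, τ.cell k i = σ.cell k i) : AllTables G τ := by
  obtain ⟨h₁, h₂, h₃⟩ := h
  refine ⟨h₁.of_cell_eq fun k i _ _ => hc k i, ?_, ?_⟩
  all_goals simpa only [hc]

theorem eval_lowest (σ : Store) (e : Expr) :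
    (lowest e).eval σ = e.eval σ - (e.eval σ &&& (e.eval σ - 1)) := rfl

theorem AllTables.row_and_col {G : SimpleGraph (Fin n)} {σ : Store} (h : AllTables G σ)
    (z : Fin n × Fin n) : σ.cell .row z.1 &&& σ.cell .col z.2 = 2 ^ pos z := by
  classical
  rw [h.tables.row_eq, h.tables.col_eq, ← bitSet_inter pos_injective, ← bitSet_singleton]
  congr 1
  ext w
  simp [Prod.ext_iff]

/-- If `front` is empty, the current class, if there is one, is complete, and the next one is
entered. -/
theorem exec_enterClass {G : SimpleGraph (Fin n)} {k : ℕ} {σ : Store} (h : LoopInvariant G k σ)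
    (hne : (Expr.add (var .rest) (var .front)).eval σ ≠ 0) :
    ∃ R₀ R W e, R.card + W.card = k ∧ W.Nonempty ∧ InClass G R₀ R W e (enterClass.exec σ) := by
  obtain ⟨R, W, hk, h⟩ := h
  have hH : Holds G R W σ := by
    rcases h with ⟨-, h, -⟩ | ⟨R₀, e, h, -, -⟩ <;> exact h
  rcases W.eq_empty_or_nonempty with rfl | hW
  · have hE : Explored G.Forces Prod.swap (arcs G) R (σ.var .bad = 0) := by
      rcases h with ⟨-, -, h⟩ | ⟨R₀, e, -, -, h⟩
      · exact h
      · exact h.finish (fun _ _ h => h.symm) fun _ _ h => h.swap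
    have hfront : σ.var .front = 0 := hH.front_eq
    have hR : R.Nonempty := by
      rw [Finset.nonempty_iff_ne_empty]
      rintro rfl
      exact hne (by simp [eval, hfront, hH.rest_eq])
    obtain ⟨e, he, hlow⟩ := exists_lowest_bit pos_injective hR
    have hexec : enterClass.exec σ =
        ((σ.set .front (2 ^ pos e)).set .rest (bitSet pos (R \ {e}))).set .rev
          (2 ^ pos e.swap) := by
      have hrev := hH.tables.row_and_col e.swap
      rw [Prod.fst_swap, Prod.snd_swap] at hrev
      rw [bitSet_sdiff (by simpa using he), bitSet_singleton, ← hrev]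
      simp [enterClass, exec, eval, hfront, block, eval_lowest, hH.rest_eq, hlow, decrease,
        hH.tables.tables.fst_eq, hH.tables.tables.snd_eq]
    refine ⟨R, R \ {e}, {e}, e, ?_, by simp, ?_⟩
    · rw [← hk, Finset.card_sdiff_of_subset (by simpa using he)]
      have := Finset.card_pos.2 hR
      simp
      omega
    · rw [hexec]
      refine ⟨⟨hH.tables.of_cell_eq fun k i => by simp, by simp, by simp⟩, by simp, ?_⟩
      simpa using hE.start he
  · have hne : (var .front).eval σ ≠ 0 := by
      simpa [eval, hH.front_eq] using hW.ne_empty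
    rw [enterClass, exec, if_neg hne]
    rcases h with ⟨rfl, -, -⟩ | ⟨R₀, e, h⟩
    · exact absurd hW (by simp)
    · exact ⟨R₀, R, W, e, hk, hW, h⟩

theorem exec_popArc {G : SimpleGraph (Fin n)} {R₀ R W : Finset (Fin n × Fin n)}
    {e : Fin n × Fin n} {σ : Store} (h : InClass G R₀ R W e σ) (hW : W.Nonempty) :
    ∃ x ∈ W, Holds G R (W \ {x}) (popArc.exec σ) ∧
      (popArc.exec σ).var .a = x.1 ∧ (popArc.exec σ).var .b = x.2 ∧
      (popArc.exec σ).var .rev = 2 ^ pos e.swap ∧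
      ((popArc.exec σ).var .bad = 0 ↔ σ.var .bad = 0 ∧ x ≠ e.swap) := by
  obtain ⟨⟨ht, hrest, hfront⟩, hrev, -⟩ := h
  obtain ⟨x, hx, hlow⟩ := exists_lowest_bit pos_injective hW
  have hexec : popArc.exec σ =
      ((((σ.set .x (2 ^ pos x)).set .front (bitSet pos (W \ {x}))).set .bad
        (σ.var .bad + (2 ^ pos x &&& 2 ^ pos e.swap))).set .a x.1).set .b x.2 := by
    rw [bitSet_sdiff (by simpa using hx), bitSet_singleton]
    simp [popArc, exec, eval, block, eval_lowest, hfront, hlow, decrease, increase, hrev,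
      ht.tables.fst_eq, ht.tables.snd_eq]
  rw [hexec]
  refine ⟨x, hx, ⟨ht.of_cell_eq fun k i => by simp, by simpa, by simp⟩, by simp, by simp, by simpa,
    ?_⟩
  simp only [Store.var_set, reduceCtorEq, if_false, if_true, two_pow_and_two_pow,
    Nat.add_eq_zero_iff, pos_injective.eq_iff]
  refine and_congr_right fun _ => ?_
  split_ifs with hxe <;> simp [hxe]

theorem exec_absorb {G : SimpleGraph (Fin n)} {R W S T : Finset (Fin n × Fin n)} {σ : Store}
    {k k' : Table} {v w : Var} (h : Holds G R W σ) (hWR : Disjoint W R)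
    (hk : σ.cell k (σ.var v) = bitSet pos S) (hk' : σ.cell k' (σ.var w) = bitSet pos T)
    (hw : w ≠ .new) :
    Holds G (R \ ((R ∩ S) \ T)) (W ∪ (R ∩ S) \ T) ((absorb k k' v w).exec σ) ∧
      ∀ u, u ≠ .new → u ≠ .rest → u ≠ .front →
        ((absorb k k' v w).exec σ).var u = σ.var u := by
  have hsub : (R ∩ S) \ T ⊆ R := Finset.sdiff_subset.trans Finset.inter_subset_left
  have hexec : (absorb k k' v w).exec σ =
      (((σ.set .new (bitSet pos (R ∩ S))).set .new (bitSet pos ((R ∩ S) \ T))).set .rest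
        (bitSet pos (R \ ((R ∩ S) \ T)))).set .front (bitSet pos (W ∪ (R ∩ S) \ T)) := by
    rw [bitSet_sdiff hsub, bitSet_union (hWR.mono_right hsub), bitSet_sdiff_inter pos_injective,
      bitSet_inter pos_injective]
    simp [absorb, exec, eval, block, decrease, increase, h.rest_eq, h.front_eq, hk, hk', hw]
  rw [hexec]
  exact ⟨⟨h.tables.of_cell_eq fun k i => by simp, by simp, by simp⟩,
    fun u h₁ h₂ h₃ => by simp [h₁, h₂, h₃]⟩

/-- Each round expands exactly one arc, so the number of arcs left to expand decreases. -/
theorem exec_explore {G : SimpleGraph (Fin n)} {k : ℕ} {σ : Store} (h : LoopInvariant G k σ)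
    (hne : (Expr.add (var .rest) (var .front)).eval σ ≠ 0) :
    ∃ k' < k, LoopInvariant G k' (explore.exec σ) := by
  classical
  obtain ⟨R₀, R, W, e, hk, hW, h₁⟩ := exec_enterClass h hne
  obtain ⟨x, hx, hH, ha, hb, hrev, hbad⟩ := exec_popArc h₁ hW
  have hE := h₁.2.2
  have hexec : explore.exec σ = (absorb .col .nbrRow .b .a).exec
    ((absorb .row .nbrCol .a .b).exec (popArc.exec (enterClass.exec σ))) := rfl
  rw [hexec]
  generalize popArc.exec (enterClass.exec σ) = τ at *
  have hWR : Disjoint W R := Finset.disjoint_left.2 fun y hy =>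
    (Finset.mem_sdiff.1 (hE.frontier_subset hy)).2
  obtain ⟨S₁, hS₁⟩ : ∃ S, S = Finset.univ.filter fun z : Fin n × Fin n => z.1 = x.1 := ⟨_, rfl⟩
  obtain ⟨T₁, hT₁⟩ : ∃ T, T = Finset.univ.filter fun z : Fin n × Fin n => G.Adj x.2 z.2 := ⟨_, rfl⟩
  obtain ⟨S₂, hS₂⟩ : ∃ S, S = Finset.univ.filter fun z : Fin n × Fin n => z.2 = x.2 := ⟨_, rfl⟩
  obtain ⟨T₂, hT₂⟩ : ∃ T, T = Finset.univ.filter fun z : Fin n × Fin n => G.Adj x.1 z.1 := ⟨_, rfl⟩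
  have hrow : τ.cell .row (τ.var .a) = bitSet pos S₁ := by
    rw [ha, hH.tables.tables.row_eq, hS₁]
  have hnbrCol : τ.cell .nbrCol (τ.var .b) = bitSet pos T₁ := by
    rw [hb, hH.tables.nbrCol_eq, hT₁]
  obtain ⟨hH₂, hv₂⟩ := exec_absorb hH (hWR.mono_left Finset.sdiff_subset) hrow hnbrCol (by decide)
  obtain ⟨N₁, hN₁⟩ : ∃ N, N = (R ∩ S₁) \ T₁ := ⟨_, rfl⟩
  rw [← hN₁] at hH₂
  generalize (absorb .row .nbrCol .a .b).exec τ = τ₂ at *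
  have ha₂ : τ₂.var .a = x.1 := (hv₂ .a (by decide) (by decide) (by decide)).trans ha
  have hb₂ : τ₂.var .b = x.2 := (hv₂ .b (by decide) (by decide) (by decide)).trans hb
  have hdisj : Disjoint (W \ {x} ∪ N₁) (R \ N₁) := by
    rw [Finset.disjoint_union_left]
    exact ⟨hWR.mono Finset.sdiff_subset Finset.sdiff_subset, Finset.disjoint_sdiff⟩
  have hcol : τ₂.cell .col (τ₂.var .b) = bitSet pos S₂ := by
    rw [hb₂, hH₂.tables.tables.col_eq, hS₂]
  have hnbrRow : τ₂.cell .nbrRow (τ₂.var .a) = bitSet pos T₂ := by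
    rw [ha₂, hH₂.tables.nbrRow_eq, hT₂]
  obtain ⟨hH₃, hv₃⟩ := exec_absorb hH₂ hdisj hcol hnbrRow (by decide)
  obtain ⟨N₂, hN₂⟩ : ∃ N, N = ((R \ N₁) ∩ S₂) \ T₂ := ⟨_, rfl⟩
  rw [← hN₂] at hH₃
  have hR' : (R \ N₁) \ N₂ ⊆ R := Finset.sdiff_subset.trans Finset.sdiff_subset
  have hN₁R : N₁ ⊆ R := hN₁ ▸ Finset.sdiff_subset.trans Finset.inter_subset_left
  have hN₂R : N₂ ⊆ R \ N₁ := hN₂ ▸ Finset.sdiff_subset.trans Finset.inter_subset_left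
  have hW' : W \ {x} ∪ N₁ ∪ N₂ = W \ {x} ∪ R \ ((R \ N₁) \ N₂) := by
    rw [Finset.union_assoc]
    congr 1
    ext z
    have h₁ := @hN₁R z
    have h₂ := @hN₂R z
    simp only [Finset.mem_union, Finset.mem_sdiff] at h₁ h₂ ⊢
    tauto
  rw [hW'] at hH₃
  -- the two absorptions move exactly the arcs forced by `x`: first those with the same tail, then
  -- those with the same head
  have hmem : ∀ z ∈ R, z ∈ (R \ N₁) \ N₂ ↔ ¬ G.Forces x z := by
    intro z hz
    have hz' : G.Adj z.1 z.2 := mem_arcs.1 (hE.subset_E (hE.subset hz))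
    have hx' : G.Adj x.1 x.2 :=
      mem_arcs.1 (hE.subset_E (Finset.mem_sdiff.1 (hE.frontier_subset hx)).1)
    simp only [hN₂, hN₁, hS₁, hT₁, hS₂, hT₂, SimpleGraph.Forces, Finset.mem_sdiff, Finset.mem_inter,
      Finset.mem_filter, Finset.mem_univ, true_and, hz, hx', hz', @eq_comm _ x.1, @eq_comm _ x.2]
    tauto
  have hexp := hE.expand hx hR' hmem
  refine ⟨_, ?_, _, _, rfl, Or.inr ⟨R₀, e, hH₃, ?_, ?_⟩⟩
  · have h₁ : (W \ {x}).card = W.card - 1 := by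
      rw [Finset.card_sdiff_of_subset (by simpa using hx), Finset.card_singleton]
    rw [← hk, Finset.card_union_of_disjoint (hWR.mono Finset.sdiff_subset Finset.sdiff_subset), h₁,
      Finset.card_sdiff_of_subset hR']
    have := Finset.card_le_card hR'
    have := Finset.card_pos.2 hW
    omega
  · rw [hv₃ _ (by decide) (by decide) (by decide), hv₂ _ (by decide) (by decide) (by decide), hrev]
  · rw [hv₃ _ (by decide) (by decide) (by decide), hv₂ _ (by decide) (by decide) (by decide), hbad]
    exact hexp

/-! ### Running time of the decision procedure -/

/-- A loop over the indices of all pairs of vertices. -/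
theorem triple_forall_pairs {I : ℕ → Store → Prop} {c : Cmd} (hc : c.LoopFree)
    (hstep : ∀ (z : Fin n × Fin n) σ, I (pos z) σ → AtPair n (pos z) σ →
      I (pos z + 1) (c.exec σ) ∧ AtPair n (pos z) (c.exec σ))
    (hadv : ∀ p σ, I p σ → I p (advance.exec σ)) :
    Triple (fun σ => I 0 σ ∧ AtPair n 0 σ)
      (.loop (.sub (var .size) (var .p)) (seq c advance))
      (fun σ => I (n * n) σ ∧ AtPair n (n * n) σ)
      ((n * n + 1) * (Cmd.loop (.sub (var .size) (var .p)) (seq c advance)).size) := by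
  have hl : (seq c advance).LoopFree := ⟨hc, by simp [advance, block, increase, LoopFree]⟩
  refine (LoopFree.triple_loop (I := fun k σ => ∃ p ≤ n * n, n * n - p = k ∧ I p σ ∧ AtPair n p σ)
    hl ?_ (n * n)).mono ?_ ?_ le_rfl
  · rintro k σ ⟨p, hp, rfl, hI, hσ⟩ hne
    have hlt : p < n * n := by
      simp only [eval, hσ.size_eq, hσ.p_eq] at hne
      omega
    obtain ⟨z, rfl⟩ := exists_pos_eq hlt
    obtain ⟨hI', hσ'⟩ := hstep z σ hI hσ
    exact ⟨_, by omega, pos z + 1, hlt, rfl, hadv _ _ hI', hσ'.advance hlt⟩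
  · exact fun σ h => ⟨0, Nat.zero_le _, rfl, h⟩
  · rintro σ ⟨⟨k, p, hp, rfl, hI, hσ⟩, h0⟩
    obtain rfl : p = n * n := by
      simp only [eval, hσ.size_eq, hσ.p_eq] at h0
      omega
    exact ⟨hI, hσ⟩

/-- The store after the computation of `size`: apart from the counter `a`, everything else is as it
was in the beginning. -/
structure Sized (G : SimpleGraph (Fin n)) (σ : Store) : Prop where
  mem_eq : σ.mem = (input G).mem
  n_eq : σ.var .n = n
  size_eq : σ.var .size = n * n
  zero : ∀ v, v ≠ .n → v ≠ .size → v ≠ .a → σ.var v = 0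

theorem triple_computeSize (G : SimpleGraph (Fin n)) :
    Triple (fun σ => Represents σ (input G)) computeSize (Sized G)
      ((n * n + 1) * computeSize.size) := by
  let I : ℕ → Store → Prop := fun k σ => ∃ i ≤ n, n - i = k ∧ σ.mem = (input G).mem ∧
    σ.var .n = n ∧ σ.var .size = i * n ∧ σ.var .a = i ∧
      ∀ v, v ≠ .n → v ≠ .size → v ≠ .a → σ.var v = 0
  have hl : (block [increase .size (var .n), increase .a (lit 1)]).LoopFree := by
    simp [block, increase, LoopFree]
  refine (LoopFree.triple_loop (I := I) (e := .sub (var .n) (var .a)) hl ?_ n).mono ?_ ?_ ?_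
  · rintro k σ ⟨i, hi, rfl, hm, hn, hs, ha, h0⟩ hne
    have hlt : i < n := by
      simp only [eval, hn, ha] at hne
      omega
    refine ⟨n - (i + 1), by omega, i + 1, hlt, rfl, ?_⟩
    simp only [block, exec, increase, eval]
    refine ⟨hm, by simp [hn], by simp [hn, hs, Nat.succ_mul], by simp [ha], fun v h₁ h₂ h₃ => ?_⟩
    simp [h₂, h₃, h0 v h₁ h₂ h₃]
  · intro σ hσ
    have hreg : ∀ v, σ.var v = if v.reg = 0 then n else 0 := fun v => (hσ.reg v).symm
    refine ⟨0, Nat.zero_le _, rfl, hσ.mem.symm, hreg _, by simp [hreg, Var.reg],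
      by simp [hreg, Var.reg], fun v hv _ _ => ?_⟩
    rw [hreg]
    exact if_neg fun h => hv (Var.reg_injective h)
  · rintro σ ⟨⟨k, i, hi, rfl, hm, hn, hs, ha, h0⟩, he⟩
    obtain rfl : i = n := by
      simp only [eval, hn, ha] at he
      omega
    exact ⟨hm, hn, hs, h0⟩
  · exact Nat.mul_le_mul_right _ (Nat.succ_le_succ (Nat.le_mul_self n))

theorem Sized.entered {G : SimpleGraph (Fin n)} {σ : Store} (h : Sized G σ) :
    Entered G 0 ((block [assign .a (lit 0), assign .x (lit 1)]).exec σ) ∧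
      AtPair n 0 ((block [assign .a (lit 0), assign .x (lit 1)]).exec σ) := by
  have hcell : ∀ k i, σ.cell k i = 0 := fun k i => by
    rw [Store.cell, h.mem_eq, mem_input_of_le]
    rw [h.size_eq]
    exact Nat.le_add_right _ _
  have h0 : ∀ v, v ≠ .n → v ≠ .size → v ≠ .a → σ.var v = 0 := h.zero
  simp only [block, exec, eval]
  constructor
  · constructor <;> simp [h0, hcell, h.mem_eq, mem_input]
  · constructor <;> simp [h0, h.n_eq, h.size_eq]

theorem Entered.neighboursEntered {G : SimpleGraph (Fin n)} {σ : Store}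
    (h : Entered G (n * n) σ) (hσ : AtPair n (n * n) σ) :
    NeighboursEntered G 0
        ((block [assign .p (lit 0), assign .a (lit 0), assign .b (lit 0)]).exec σ) ∧
      AtPair n 0 ((block [assign .p (lit 0), assign .a (lit 0), assign .b (lit 0)]).exec σ) := by
  simp only [block, exec, eval]
  refine ⟨⟨⟨?_, ?_, ?_, ?_⟩, ?_, ?_, ?_, ?_, ?_, ?_⟩, ?_⟩
  · simp [h.row_eq, pos_lt]
  · simp [h.col_eq, pos_lt]
  · simp [h.fst_eq, pos_lt]
  · simp [h.snd_eq, pos_lt]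
  · simp [h.input_eq]
  · simp only [Store.var_set, reduceCtorEq, if_false, h.rest_eq]
    congr 1
    ext z
    simp [pos_lt]
  · simp [h.front_eq]
  · simp [h.bad_eq]
  · simp [h.nbrRow_eq]
  · simp [h.nbrCol_eq]
  · constructor <;> simp [hσ.n_eq, hσ.size_eq]

theorem NeighboursEntered.loopInvariant {G : SimpleGraph (Fin n)} {σ : Store}
    (h : NeighboursEntered G (n * n) σ) : LoopInvariant G (arcs G).card σ := by
  refine ⟨arcs G, ∅, by simp, Or.inl ⟨rfl, ⟨⟨h.tables, ?_, ?_⟩, ?_, ?_⟩, ?_, ?_, ?_⟩⟩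
  · intro i
    rw [h.nbrRow_eq]
    congr 1
    ext z
    simp [pos_lt]
  · intro i
    rw [h.nbrCol_eq]
    congr 1
    ext z
    simp [pos_lt]
  · exact h.rest_eq
  · exact h.front_eq
  · exact Finset.Subset.rfl
  · exact fun y _ z hyz => mem_arcs.2 hyz.2.1
  · simp [h.bad_eq]

/-- When the main loop ends, `bad` tells whether some class contains opposite arcs. -/
theorem LoopInvariant.bad_eq_zero_iff {G : SimpleGraph (Fin n)} {k : ℕ} {σ : Store}
    (h : LoopInvariant G k σ) (he : (Expr.add (var .rest) (var .front)).eval σ = 0) :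
    σ.var .bad = 0 ↔ ¬ G.HasForcedConflict := by
  obtain ⟨R, W, -, h⟩ := h
  have hH : Holds G R W σ := by
    rcases h with ⟨-, h, -⟩ | ⟨R₀, e, h, -, -⟩ <;> exact h
  obtain ⟨rfl, rfl⟩ : R = ∅ ∧ W = ∅ := by
    simpa [eval, hH.rest_eq, hH.front_eq] using he
  have hE : Explored G.Forces Prod.swap (arcs G) ∅ (σ.var .bad = 0) := by
    rcases h with ⟨-, -, h⟩ | ⟨R₀, e, -, -, h⟩
    · exact h
    · exact h.finish (fun _ _ h => h.symm) fun _ _ h => h.swap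
  rw [hE.ok_iff, Finset.sdiff_empty, SimpleGraph.HasForcedConflict]
  push Not
  simp only [mem_arcs]
  rfl

theorem card_arcs_le (G : SimpleGraph (Fin n)) : (arcs G).card ≤ n * n :=
  (Finset.card_le_univ _).trans (by simp)

theorem triple_decideOrientation (G : SimpleGraph (Fin n)) :
    Triple (fun σ => Represents σ (input G)) decideOrientation
      (fun σ => G.HasTransitiveOrientation ∧ σ.var .n = 1 ∨
        ¬ G.HasTransitiveOrientation ∧ σ.var .n = 0)
      ((n * n + 1) * decideOrientation.size) := by
  have hm : 0 < n * n + 1 := Nat.succ_pos _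
  refine (triple_computeSize G).seq_mul <| Triple.seq_mul
    (LoopFree.triple_mul hm (by simp [block, LoopFree]) fun σ h => h.entered) <| Triple.seq_mul
    (triple_forall_pairs (I := Entered G) (c := enterPair)
      (by simp [enterPair, block, storeCell, increase, LoopFree])
      (fun z σ h hσ => h.enterPair hσ) fun p σ h => h.advance) <| Triple.seq_mul
    (LoopFree.triple_mul hm (by simp [block, LoopFree]) fun σ h => h.1.neighboursEntered h.2) <|
    Triple.seq_mul (triple_forall_pairs (I := NeighboursEntered G) (c := enterNeighbour)
      (by simp [enterNeighbour, block, storeCell, LoopFree])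
      (fun z σ h hσ => h.enterNeighbour hσ) fun p σ h => h.advance) <| Triple.seq_mul
    ((LoopFree.triple_loop (I := LoopInvariant G) (c := explore)
      (by simp [explore, enterClass, popArc, absorb, block, increase, decrease, LoopFree])
      (fun k σ h hne => exec_explore h hne) (arcs G).card).mono
      (fun σ h => h.1.loopInvariant) (fun σ h => h)
      (Nat.mul_le_mul_right _ (Nat.succ_le_succ (card_arcs_le G)))) <|
    Triple.seq_mul (B := fun σ => G.HasTransitiveOrientation ∧ σ.var .n = 1 ∨
        ¬ G.HasTransitiveOrientation ∧ σ.var .n = 0)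
      (LoopFree.triple_mul hm trivial ?_)
      (LoopFree.triple_mul hm (c := .skip) trivial fun σ h => h)
  rintro σ ⟨⟨k, h⟩, he⟩
  have hbad := h.bad_eq_zero_iff he
  rw [← SimpleGraph.hasTransitiveOrientation_iff] at hbad
  rw [← hbad]
  by_cases h0 : σ.var .bad = 0
  · exact Or.inl ⟨h0, by simp [exec, eval, h0]⟩
  · exact Or.inr ⟨h0, by simp [exec, eval]; omega⟩

theorem decidableInTimeO_hasTransitiveOrientation :
    DecidableInTimeO (fun _ G => G.HasTransitiveOrientation) fun n => (n : ℝ) ^ 2 := by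
  refine ⟨decideOrientation.compile 0, fun n => (n * n + 1) * decideOrientation.size, ?_,
    decidesWithin_of_triple fun n G => triple_decideOrientation G⟩
  refine IsBigO.of_bound (2 * decideOrientation.size) ?_
  filter_upwards [eventually_ge_atTop 1] with n hn
  -- for `1 ≤ n`, the factor `n * n + 1` is at most `2 * n ^ 2`
  have hn' : (1 : ℝ) ≤ (n : ℝ) ^ 2 := one_le_pow₀ (by exact_mod_cast hn)
  have hs : (0 : ℝ) ≤ decideOrientation.size := Nat.cast_nonneg _
  rw [Real.norm_of_nonneg (Nat.cast_nonneg _), Real.norm_of_nonneg (by positivity)]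
  push_cast
  nlinarith

end RAM

theorem mainTheorem4 :
    (∀ (V : Type*) [Fintype V] (D : Digraph V), D.Loopless →
      D.numArcs ≤ D.wienerIndex ∧ (D.wienerIndex = D.numArcs ↔ D.IsTransitive)) ∧
    (∀ (V : Type*) [Fintype V] (G : SimpleGraph V),
      (∀ D : Digraph V, D.IsOrientationOf G → G.numEdges ≤ D.wienerIndex) ∧
      (G.HasOrientationOfWienerIndexNumEdges ↔ G.HasTransitiveOrientation)) ∧
    RAM.DecidableInTimeO (fun _ G => G.HasTransitiveOrientation) (fun n => (n : ℝ) ^ 2) ∧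
    RAM.DecidableInTimeO (fun _ G => G.HasOrientationOfWienerIndexNumEdges)
      (fun n => (n : ℝ) ^ 2) := by
  refine ⟨fun V _ D hD => ⟨Digraph.numArcs_le_wienerIndex hD,
    Digraph.wienerIndex_eq_numArcs_iff hD⟩, fun V _ G => ⟨fun D hD => ?_,
    G.hasOrientationOfWienerIndexNumEdges_iff⟩,
    RAM.decidableInTimeO_hasTransitiveOrientation, ?_⟩
  · rw [← hD.numArcs_eq]
    exact Digraph.numArcs_le_wienerIndex hD.loopless
  · simp only [SimpleGraph.hasOrientationOfWienerIndexNumEdges_iff]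
    exact RAM.decidableInTimeO_hasTransitiveOrientation
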